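/- Let $n,N\ge 1$ and let $|\cdot|$ be the Euclidean norm. A function $\alpha:\mathbb R\to\mathbb R$ is of class $\mathcal K^e$ if it is continuous, strictly increasing and $\alpha(0)=0$. For $f:\mathbb R^d\to\mathbb R$ Lipschitz near $x$, put $f^\circ(x,v)=\limsup_{y\to x,\lambda\downarrow0}\frac{f(y+\lambda v)-f(y)}{\lambda}$ and $\partial f(x)=\{\epsilon: \epsilon^Tv\le f^\circ(x,v)\ \forall v\}$ (Clarke's generalized gradient). **System.** Consider $M(q)\ddot q+C(q,\dot q)\dot q+N(q,\dot q)=u$ on $\mathbb R^n$, where $M$ is continuously differentiable, each $M(q)$ is symmetric and invertible with $\mu_{m1}I<M(q)<\mu_{m2}I$ for constants $\mu_{m1},\mu_{m2}>0$, and $\dot M-2C$ is skew-symmetric for all $(q,\dot q)$, with $\dot M=DM(q)[\dot q]$. Let $v_c^d>0$ be a bound for the derivative of the velocity command $v_c$. **Obstacles.** Let $q_{oi}\in\mathbb R^n$, $d_{si}>0$, $h_i(q)=|q_{oi}-q|-d_{si}$ $(i=1,\dots,N)$, $\underline d_s=\min_i d_{si}$, $\overline d_s=\max_i d_{si}$.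 Let $0<d_a<\underline d_s$, $d_b>0$, $0<d_h<\underline d_s$ be such that whenever $h_i(q)\ge-d_h$ for all $i$ and $h_j(q)\le d_b/2$, $h_k(q)\le d_b/2$, then $|q_{oj}-q_{ok}|\le d_a$. **Conditions.** Let $\bar v,d_r>0$ satisfy $\sqrt2\,\underline d_s>d_a$, $\bar v>2d_r$ and $$\frac{2\underline d_s^2-d_a^2}{2(\overline d_s+d_b/2)^2}>1-\frac{(\bar v-2d_r)^2}{2(\bar v-d_r)^2}.$$ Put $c^*=\frac{(2\overline d_s+d_b)^2-4\underline d_s^2+2d_a^2}{2(2\overline d_s+d_b)^2}$ and $g=\sqrt{c^*+\frac{d_r}{\bar v-d_r}}-\sqrt{c^*}$. **Admissible designs.** A triple $(c_0,\alpha_c,\phi)$ is admissible if $0<c_0<1$; $\alpha_c\in\mathcal K^e$ is a Lipschitz bijection of $\mathbb R$ with Lipschitz inverse; $\phi:[-1,1]\to[0,\infty)$ is Lipschitz and nonincreasing; $c_0>\sqrt{c^*}+\sqrt{c^*+\frac{d_r}{\bar v-d_r}}$; $$c_0(\bar v-d_r)\ge c_0\alpha_c(d_b/2)-d_r>\frac{d_r-c_0\alpha_c(-d_h)}{g};$$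 $\phi(s)=0$ for $s\in[c_0,1]$; and for all $s\in[-1,c_0)$, $p\in[0,d_h]$ and $K\in\{c_0(\bar v-d_r),\,(d_r-c_0\alpha_c(-p))/g\}$, $$\phi(s)>\alpha_c^{-1}\Big(\frac{-K(s-c_0)}{c_0}+\frac{-Kg+d_r}{c_0}\Big)+p.$$ **Outer loop.** Let $l_1,\dots,l_m\in\mathbb R^n$ be unit vectors such that for every unit vector $l_o$ the set $\{l_p: l_p^Tl_o\ge c_0\}$ has at least $n$ elements and $l_o$ is a combination of its elements with nonnegative coefficients. With $l_{oi}(q)=\frac{q_{oi}-q}{|q_{oi}-q|}$ and $r(q,l)=\min_i\{|q_{oi}-q|-d_{si}+\phi(l_{oi}(q)^Tl)\}$, let $v^*=\varphi(q,v_c)$ be the minimizer of $|v-v_c|^2$ over all $v\in\mathbb R^n$ with $l_k^Tv\le c_0\alpha_c(r(q,l_k))-d_r$ and $l_k^Tv\le c_0(\bar v-d_r)$ for $k=1,\dots,m$. **Theorem.** Admissible triples $(c_0,\alpha_c,\phi)$ exist, and for each of them and all $l_1,\dots,l_m$ as above there is $\Delta_h>0$ such that: 1. if $h_i(q)\ge-\Delta_h$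 for all $i$, then for every $v_c\in\mathbb R^n$ the minimizer $\varphi(q,v_c)$ exists and is unique; and there is $L>0$ with $$|\varphi(q_1,v_{c1})-\varphi(q_2,v_{c2})|\le L(|q_1-q_2|+|v_{c1}-v_{c2}|)\qquad(*)$$ for all $v_{c1},v_{c2}\in\mathbb R^n$ and all $q_1,q_2$ with $\min\{h_i(q_1),h_i(q_2)\}\ge-\Delta_h$ for all $i$; 2. for every $L>0$ satisfying $(*)$ and every $k_D>2nL\frac{\mu_{m2}^3(v_c^d+\bar v)}{\mu_{m1}^2d_r}$ there are a Lipschitz function $\alpha_w\in\mathcal K^e$ and $d_w>0$ such that, with $W=\max\{-h_1(q),\dots,-h_N(q),W_{N+1}\}$ and $$W_{N+1}(q,\dot q,v_c)=-\frac{nL\mu_{m1}\mu_{m2}^2(v_c^d+\bar v-d_r)d_r}{\mu_{m1}k_D-2nL\mu_{m2}^2}+\tfrac12(\dot q-\varphi(q,v_c))^TM(q)(\dot q-\varphi(q,v_c)),$$ for all $q,\dot q,v_c\in\mathbb R^n$ with $W(q,\dot q,v_c)\le d_w$: $W$ is Lipschitz near $(q,\dot q,v_c)$, and $$\delta^T[\dot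 q;\ddot q;\dot v_c]\le-\alpha_w(W(q,\dot q,v_c))\qquad\forall\,\delta\in\partial W(q,\dot q,v_c),$$ for every $\dot v_c$ with $|\dot v_c|\le v_c^d$ and for $\ddot q$ given by the system under the control law $u=N(q,\dot q)+C(q,\dot q)v^*-k_D(\dot q-v^*)$, $v^*=\varphi(q,v_c)$. -/

import Mathlib

open scoped NNReal Matrix

noncomputable section

/-- Class `𝒦ᵉ`: continuous, strictly increasing functions `ℝ → ℝ` vanishing at `0`. -/
def IsClassKe (α : ℝ → ℝ) : Prop :=
  Continuous α ∧ StrictMono α ∧ α 0 = 0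

/-- Clarke's generalized directional derivative
`f°(x, v) = limsup_{y → x, t ↓ 0} (f (y + t v) - f y) / t`.
The limsup is taken in the extended reals; it is finite wherever `f` is Lipschitz near `x`. -/
def clarkeDirDeriv {X : Type*} [NormedAddCommGroup X] [NormedSpace ℝ X]
    (f : X → ℝ) (x v : X) : EReal :=
  Filter.limsup (fun p : X × ℝ => (((f (p.1 + p.2 • v) - f p.1) / p.2 : ℝ) : EReal))
    (nhds x ×ˢ nhdsWithin (0 : ℝ) (Set.Ioi 0))

/-- Clarke's generalized gradient `∂f(x)`, the row vectors `δᵀ` being regarded as linear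
functionals. -/
def clarkeGradient {X : Type*} [NormedAddCommGroup X] [NormedSpace ℝ X]
    (f : X → ℝ) (x : X) : Set (X →L[ℝ] ℝ) :=
  {δ | ∀ v : X, ((δ v : ℝ) : EReal) ≤ clarkeDirDeriv f x v}

/-- Data of the `n`-degree-of-freedom system `M(q) q̈ + C(q, q̇) q̇ + N(q, q̇) = u`. -/
structure ELSystem (n : ℕ) where
  M : EuclideanSpace ℝ (Fin n) → Matrix (Fin n) (Fin n) ℝ
  C : EuclideanSpace ℝ (Fin n) → EuclideanSpace ℝ (Fin n) → Matrix (Fin n) (Fin n) ℝ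
  N : EuclideanSpace ℝ (Fin n) → EuclideanSpace ℝ (Fin n) → EuclideanSpace ℝ (Fin n)

namespace ELSystem

variable {n : ℕ}

/-- `Ṁ` at position `q` and velocity `qd`: the entrywise derivative of `M` at `q` along `qd`. -/
def Mdot (S : ELSystem n) (q qd : EuclideanSpace ℝ (Fin n)) : Matrix (Fin n) (Fin n) ℝ :=
  Matrix.of fun i j => fderiv ℝ (fun x => S.M x i j) q qd

/-- The standing assumption on the system: `M` is continuously differentiable, `Ṁ - 2C` is
skew-symmetric, and `M(q)` is invertible, symmetric with `μ₁ I < M(q) < μ₂ I`. -/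
structure Standing (S : ELSystem n) (μ₁ μ₂ : ℝ) : Prop where
  contDiff : ∀ i j, ContDiff ℝ 1 (fun q => S.M q i j)
  skew : ∀ q qd, (S.Mdot q qd - (2 : ℝ) • S.C q qd) + (S.Mdot q qd - (2 : ℝ) • S.C q qd)ᵀ = 0
  invertible : ∀ q, IsUnit (S.M q)
  symm : ∀ q, (S.M q).IsSymm
  lower_pos : 0 < μ₁
  upper_pos : 0 < μ₂
  lower : ∀ q, (S.M q - μ₁ • (1 : Matrix (Fin n) (Fin n) ℝ)).PosDef
  upper : ∀ q, (μ₂ • (1 : Matrix (Fin n) (Fin n) ℝ) - S.M q).PosDef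

/-- The equation of motion holds at position `q`, velocity `qd`, acceleration `qdd`, input `u`. -/
def Motion (S : ELSystem n) (q qd qdd u : EuclideanSpace ℝ (Fin n)) : Prop :=
  (S.M q).toEuclideanLin qdd + (S.C q qd).toEuclideanLin qd + S.N q qd = u

/-- The velocity-tracking control law `u = N(q, q̇) + C(q, q̇) v* - k_D (q̇ - v*)`. -/
def trackingInput (S : ELSystem n) (kD : ℝ) (q qd vs : EuclideanSpace ℝ (Fin n)) :
    EuclideanSpace ℝ (Fin n) :=
  S.N q qd + (S.C q qd).toEuclideanLin vs - kD • (qd - vs)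

end ELSystem

/-- `N` ball obstacles: positions `q_{oi}` and safety margins `d_{si}`. -/
structure Obstacles (n N : ℕ) where
  pos : Fin N → EuclideanSpace ℝ (Fin n)
  ds : Fin N → ℝ

namespace Obstacles

variable {n N : ℕ}

/-- `h_i(q) = |q_{oi} - q| - d_{si}`. -/
def h (O : Obstacles n N) (i : Fin N) (q : EuclideanSpace ℝ (Fin n)) : ℝ :=
  ‖O.pos i - q‖ - O.ds i

/-- The unit vector `l_{oi}(q)` from `q` to the `i`-th obstacle. -/
def dir (O : Obstacles n N) (i : Fin N) (q : EuclideanSpace ℝ (Fin n)) :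
    EuclideanSpace ℝ (Fin n) :=
  ‖O.pos i - q‖⁻¹ • (O.pos i - q)

/-- The smallest safety margin. -/
def dsMin (O : Obstacles n N) : ℝ := ⨅ i, O.ds i

/-- The largest safety margin. -/
def dsMax (O : Obstacles n N) : ℝ := ⨆ i, O.ds i

/-- The distance condition on the obstacles with constants `d_a`, `d_b`, `d_h`. -/
structure DistanceCondition (O : Obstacles n N) (da db dh : ℝ) : Prop where
  da_pos : 0 < da
  da_lt : da < O.dsMin
  db_pos : 0 < db
  dh_pos : 0 < dh
  dh_lt : dh < O.dsMin
  close : ∀ q, (∀ i, -dh ≤ O.h i q) →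
    ∀ j k, O.h j q ≤ db / 2 → O.h k q ≤ db / 2 → ‖O.pos j - O.pos k‖ ≤ da

/-- `c* = ((2 d̄_s + d_b)² - 4 d̲_s² + 2 d_a²) / (2 (2 d̄_s + d_b)²)`. -/
def cStar (O : Obstacles n N) (da db : ℝ) : ℝ :=
  ((2 * O.dsMax + db) ^ 2 - 4 * O.dsMin ^ 2 + 2 * da ^ 2) / (2 * (2 * O.dsMax + db) ^ 2)

end Obstacles

/-- The design parameters `c₀`, `α_c` (with its inverse) and `φ` of the outer loop. Only the values
of `φ` on `[-1, 1]` matter. -/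
structure Design where
  c₀ : ℝ
  α : ℝ ≃ ℝ
  φ : ℝ → ℝ

/-- The requirements on the design parameters. -/
structure Design.Admissible {n N : ℕ} (D : Design) (O : Obstacles n N)
    (da db dh vbar dr : ℝ) : Prop where
  c₀_pos : 0 < D.c₀
  c₀_lt_one : D.c₀ < 1
  α_classKe : IsClassKe D.α
  α_lipschitz : ∃ K : ℝ≥0, LipschitzWith K D.α
  α_inv_lipschitz : ∃ K : ℝ≥0, LipschitzWith K D.α.symm
  φ_lipschitz : ∃ K : ℝ≥0, LipschitzOnWith K D.φ (Set.Icc (-1) 1)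
  φ_nonneg : ∀ s ∈ Set.Icc (-1 : ℝ) 1, 0 ≤ D.φ s
  φ_antitone : AntitoneOn D.φ (Set.Icc (-1) 1)
  c₀_large : D.c₀ > √(O.cStar da db) + √(O.cStar da db + dr / (vbar - dr))
  α_upper : D.c₀ * (vbar - dr) ≥ D.c₀ * D.α (db / 2) - dr
  α_lower : D.c₀ * D.α (db / 2) - dr >
    (dr - D.c₀ * D.α (-dh)) / (√(O.cStar da db + dr / (vbar - dr)) - √(O.cStar da db))
  φ_large : ∀ s ∈ Set.Ico (-1) D.c₀, ∀ p ∈ Set.Icc 0 dh,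
    ∀ K ∈ ({D.c₀ * (vbar - dr), (dr - D.c₀ * D.α (-p)) /
        (√(O.cStar da db + dr / (vbar - dr)) - √(O.cStar da db))} : Set ℝ),
      D.φ s > D.α.symm (-K * (s - D.c₀) / D.c₀ +
        (-K * (√(O.cStar da db + dr / (vbar - dr)) - √(O.cStar da db)) + dr) / D.c₀) + p
  φ_zero : ∀ s ∈ Set.Icc D.c₀ 1, D.φ s = 0

/-- The unit vectors `l_1, …, l_m` form a positive basis adapted to `c₀`: for every unit vector
`lo`, the set of those `l_p` with `l_pᵀ lo ≥ c₀` has at least `n` elements, and `lo` is a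
combination of them with nonnegative coefficients. -/
def IsPositiveBasis {n m : ℕ} (c₀ : ℝ) (l : Fin m → EuclideanSpace ℝ (Fin n)) : Prop :=
  (∀ k, ‖l k‖ = 1) ∧
  ∀ lo : EuclideanSpace ℝ (Fin n), ‖lo‖ = 1 →
    n ≤ {x | ∃ p, l p = x ∧ c₀ ≤ inner ℝ (l p) lo}.ncard ∧
    ∃ ρ : Fin m → ℝ, (∀ p, 0 ≤ ρ p) ∧ (∀ p, ρ p ≠ 0 → c₀ ≤ inner ℝ (l p) lo) ∧
      lo = ∑ p, ρ p • l p

section OuterLoop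

variable {n N m : ℕ}

/-- The distance-regularization function `r(q, l)`. -/
def regDist (O : Obstacles n N) (D : Design) (q l : EuclideanSpace ℝ (Fin n)) : ℝ :=
  ⨅ i, (‖O.pos i - q‖ - O.ds i + D.φ (inner ℝ (O.dir i q) l))

/-- The feasible set of the quadratic program at `q`. -/
def qpFeasible (O : Obstacles n N) (D : Design) (l : Fin m → EuclideanSpace ℝ (Fin n))
    (vbar dr : ℝ) (q : EuclideanSpace ℝ (Fin n)) : Set (EuclideanSpace ℝ (Fin n)) :=
  {v | ∀ k, inner ℝ (l k) v ≤ D.c₀ * D.α (regDist O D q (l k)) - dr ∧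
    inner ℝ (l k) v ≤ D.c₀ * (vbar - dr)}

/-- `v` solves the quadratic program at `(q, vc)`. -/
def IsQPSolution (O : Obstacles n N) (D : Design) (l : Fin m → EuclideanSpace ℝ (Fin n))
    (vbar dr : ℝ) (q vc v : EuclideanSpace ℝ (Fin n)) : Prop :=
  v ∈ qpFeasible O D l vbar dr q ∧
    ∀ w ∈ qpFeasible O D l vbar dr q, ‖v - vc‖ ^ 2 ≤ ‖w - vc‖ ^ 2

/-- The map `v* = φ(q, v_c)` given by the solution of the quadratic program (an arbitrary value
where there is no solution). -/
def qpMap (O : Obstacles n N) (D : Design) (l : Fin m → EuclideanSpace ℝ (Fin n))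
    (vbar dr : ℝ) (q vc : EuclideanSpace ℝ (Fin n)) : EuclideanSpace ℝ (Fin n) :=
  Classical.epsilon fun v => IsQPSolution O D l vbar dr q vc v

/-- The Lipschitz estimate with constant `L` for the map `φ` on the set where
`h_i(q) ≥ -Δ_h` for all `i`. -/
def OuterLipschitz (O : Obstacles n N) (φ : EuclideanSpace ℝ (Fin n) → EuclideanSpace ℝ (Fin n) →
    EuclideanSpace ℝ (Fin n)) (Δh L : ℝ) : Prop :=
  ∀ q₁ q₂ vc₁ vc₂, (∀ i, -Δh ≤ min (O.h i q₁) (O.h i q₂)) →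
    ‖φ q₁ vc₁ - φ q₂ vc₂‖ ≤ L * (‖q₁ - q₂‖ + ‖vc₁ - vc₂‖)

/-- The function `W_{N+1}` of `(q, q̇, v_c)`, for the outer-loop map `φ`. -/
def trackingW (S : ELSystem n) (φ : EuclideanSpace ℝ (Fin n) → EuclideanSpace ℝ (Fin n) →
    EuclideanSpace ℝ (Fin n)) (μ₁ μ₂ vcd vbar dr kD L : ℝ)
    (x : EuclideanSpace ℝ (Fin n) × EuclideanSpace ℝ (Fin n) × EuclideanSpace ℝ (Fin n)) : ℝ :=
  -(n * L * μ₁ * μ₂ ^ 2 * (vcd + vbar - dr) * dr / (μ₁ * kD - 2 * n * L * μ₂ ^ 2)) +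
    1 / 2 * inner ℝ (x.2.1 - φ x.1 x.2.2)
      ((S.M x.1).toEuclideanLin (x.2.1 - φ x.1 x.2.2))

/-- `W = max {-h_1, …, -h_N, W_{N+1}}`. -/
def maxW (S : ELSystem n) (O : Obstacles n N) (φ : EuclideanSpace ℝ (Fin n) →
    EuclideanSpace ℝ (Fin n) → EuclideanSpace ℝ (Fin n)) (μ₁ μ₂ vcd vbar dr kD L : ℝ)
    (x : EuclideanSpace ℝ (Fin n) × EuclideanSpace ℝ (Fin n) × EuclideanSpace ℝ (Fin n)) : ℝ :=
  max (⨆ i, -O.h i x.1) (trackingW S φ μ₁ μ₂ vcd vbar dr kD L x)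

end OuterLoop

end

/-! Write `x = √c*`, `y = √(c* + dr/(vbar - dr))`, `g = y - x`, and let `e` be the velocity tracking
error. Three arguments are combined.

Feasibility. The inequality on the obstacle distances says that `2x + dr/(vbar - dr) < 1`,
equivalently `x + y < 1`, so `c₀` fits between `x + y` and `1`; a piecewise linear `α` and `φ` then
give an admissible design (`exists_admissible`). For a small safety tolerance, the directions to any
two close obstacles differ by at most `2x`. Retreating from one of them at a suitable speed
therefore respects the constraints coming from all of them (`qpFeasible_nonempty`).

Lipschitz dependence. The feasible set is a polyhedron with fixed normals and with offsets Lipschitz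
in `q`, and the quadratic program is the projection onto it. Projection is nonexpansive in the
target. Along a segment of offsets the multipliers can be chosen with linearly independent support;
parameters whose supports lie in a common independent family form finitely many sets, on each of
which the projection is Lipschitz with one constant (`exists_lipschitz_nearest_polyhedron`).

Decay. Only the functions active in the maximum `W` contribute to its generalized gradient. If
`-h_j` is active, the positive basis turns the constraints into a bound on the velocity of `v*`
towards obstacle `j` with margin `dr`, and `W ≥ W_{N+1}` keeps `e` small enough to be absorbed by
that margin. If `W_{N+1}` is active, skew-symmetry of `Ṁ - 2C` leaves `-kD|e|²` plus a drift at most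
`μ₂|e|L(|q̇| + |v̇c|)`, where `|q̇| ≤ |e| + vbar - dr`. The level subtracted in `W_{N+1}` must be
small against `dr²` yet large against the drift; the gain condition secures both
(`tracking_level_bounds`). -/

/-! ### Projections onto polyhedra with fixed normals -/

section PolyhedralProjection

/-- If `[0, 1]` is covered by finitely many sets on each of which the continuous function `f` is
Lipschitz with constant `C`, then `‖f 1 - f 0‖ ≤ C`. -/
theorem norm_sub_le_of_finite_cover {E : Type*} [NormedAddCommGroup E] {f : ℝ → E}
    (hf : ContinuousOn f (Set.Icc 0 1)) {ι : Type*} [Finite ι] (T : ι → Set ℝ)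
    (hT : ∀ t ∈ Set.Icc (0 : ℝ) 1, ∃ j, t ∈ T j) {C : ℝ}
    (hC : ∀ j, ∀ s ∈ T j ∩ Set.Icc 0 1, ∀ t ∈ T j ∩ Set.Icc 0 1, ‖f s - f t‖ ≤ C * |s - t|) :
    ‖f 1 - f 0‖ ≤ C := by
  have hg : ContinuousOn (fun t => ‖f t - f 0‖) (Set.Icc 0 1) :=
    (hf.sub continuousOn_const).norm
  -- This comparison needs only the lower right Dini derivative, so slopes have to be bounded only
  -- at some points accumulating at `x` from the right.
  have key := image_le_of_liminf_slope_right_le_deriv_boundary (f := fun t => ‖f t - f 0‖)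
    (a := 0) (b := 1) hg (B := fun t => C * t) (B' := fun _ => C) (by simp)
    (by fun_prop) (fun x _ => by
      simpa using ((hasDerivAt_id x).const_mul C).hasDerivWithinAt) ?_
    (Set.right_mem_Icc.2 zero_le_one)
  · simpa using key
  intro x hx r hr
  have hIoc : ∀ᶠ z in nhdsWithin x (Set.Ioi x), z ∈ Set.Ioc x 1 :=
    Ioc_mem_nhdsGT hx.2
  have hj : ∃ j, ∃ᶠ z in nhdsWithin x (Set.Ioi x), z ∈ T j := by
    by_contra hcon
    simp only [not_exists, Filter.not_frequently] at hcon
    have hall := Filter.eventually_all.2 hcon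
    obtain ⟨z, hz, hz'⟩ := (hall.and hIoc).exists
    obtain ⟨j, hj⟩ := hT z ⟨hx.1.trans hz'.1.le, hz'.2⟩
    exact hz j hj
  obtain ⟨j, hj⟩ := hj
  have hfx : Filter.Tendsto f (nhdsWithin x (Set.Ioi x)) (nhds (f x)) := by
    have h1 : Filter.Tendsto f (nhdsWithin x (Set.Ioc x 1)) (nhds (f x)) :=
      (hf x ⟨hx.1, hx.2.le⟩).mono_left
        (nhdsWithin_mono x (fun z hz => ⟨hx.1.trans hz.1.le, hz.2⟩))
    rwa [nhdsWithin_Ioc_eq_nhdsGT hx.2] at h1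
  refine (hj.and_eventually hIoc).mono fun z hz => ?_
  have hzI : z ∈ Set.Icc (0 : ℝ) 1 := ⟨hx.1.trans hz.2.1.le, hz.2.2⟩
  -- The point `x` need not belong to `T j`; the estimate is obtained by letting `y → x` within `T
  -- j`, using continuity of `f`.
  have hlim : ‖f z - f x‖ ≤ C * |z - x| := by
    have h1 : Filter.Tendsto (fun y => C * |z - y| - ‖f z - f y‖) (nhdsWithin x (Set.Ioi x))
        (nhds (C * |z - x| - ‖f z - f x‖)) := by
      refine Filter.Tendsto.sub ?_ (tendsto_const_nhds.sub hfx).norm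
      have : Continuous fun y : ℝ => C * |z - y| := by fun_prop
      exact this.continuousAt.tendsto.mono_left nhdsWithin_le_nhds
    have h2 := ge_of_tendsto_of_frequently (b := (0 : ℝ)) h1 ((hj.and_eventually hIoc).mono fun y hy => by
      have := hC j z ⟨hz.1, hzI⟩ y ⟨hy.1, hx.1.trans hy.2.1.le, hy.2.2⟩
      linarith)
    linarith
  have hpos : 0 < z - x := sub_pos.2 hz.2.1
  rw [abs_of_pos hpos] at hlim
  have htri : ‖f z - f 0‖ ≤ ‖f z - f x‖ + ‖f x - f 0‖ := norm_sub_le_norm_sub_add_norm_sub _ _ _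
  have : slope (fun t => ‖f t - f 0‖) x z ≤ C := by
    rw [slope_def_field, div_le_iff₀ hpos]
    linarith
  exact this.trans_lt hr

/-- Carathéodory's theorem for finitely generated cones. -/
theorem exists_linearIndepOn_nonneg_combination {E κ : Type*} [AddCommGroup E] [Module ℝ E]
    [Fintype κ] (l : κ → E) (μ : κ → ℝ) (hμ : ∀ k, 0 ≤ μ k) :
    ∃ ν : κ → ℝ, (∀ k, 0 ≤ ν k) ∧ (∀ k, ν k ≠ 0 → μ k ≠ 0) ∧
      LinearIndepOn ℝ l {k | ν k ≠ 0} ∧ ∑ k, ν k • l k = ∑ k, μ k • l k := by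
  classical
  induction hc : (Finset.univ.filter fun k => μ k ≠ 0).card using Nat.strong_induction_on
    generalizing μ with
  | _ c ih =>
  by_cases hind : LinearIndepOn ℝ l {k | μ k ≠ 0}
  · exact ⟨μ, hμ, fun _ h => h, hind, rfl⟩
  have hdep : ∃ a : κ → ℝ, (∀ k, a k ≠ 0 → μ k ≠ 0) ∧ ∑ k, a k • l k = 0 ∧ ∃ k, 0 < a k := by
    have hset : {k | μ k ≠ 0} = ((Finset.univ.filter fun k => μ k ≠ 0 : Finset κ) : Set κ) := by
      ext; simp
    rw [hset, linearIndepOn_finset_iff] at hind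
    push Not at hind
    obtain ⟨a, ha0, k, hk, hak⟩ := hind
    have hsum : ∑ i, (if μ i ≠ 0 then a i else 0) • l i = 0 := by
      rw [← ha0, Finset.sum_filter]
      exact Finset.sum_congr rfl fun i _ => by split_ifs <;> simp
    have hk' : μ k ≠ 0 := by simpa using hk
    rcases lt_or_gt_of_ne hak with h | h
    · refine ⟨fun i => -(if μ i ≠ 0 then a i else 0), fun i hi => ?_, ?_, k, ?_⟩
      · by_contra h0
        simp [h0] at hi
      · simpa only [neg_smul, Finset.sum_neg_distrib, neg_eq_zero] using hsum
      · simp [hk', h]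
    · refine ⟨fun i => (if μ i ≠ 0 then a i else 0), fun i hi => ?_, hsum, k, ?_⟩
      · by_contra h0
        simp [h0] at hi
      · simp [hk', h]
  obtain ⟨a, hsupp, hsum, k₀, hk₀⟩ := hdep
  obtain ⟨k, hk, hmin⟩ := Finset.exists_min_image (Finset.univ.filter fun k => 0 < a k)
    (fun k => μ k / a k) ⟨k₀, by simpa using hk₀⟩
  have hak : 0 < a k := by simpa using hk
  have hμk : 0 < μ k := lt_of_le_of_ne (hμ k) (hsupp k hak.ne').symm
  -- The largest multiple of the dependency that can be subtracted while all coefficients stay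
  -- nonnegative; it removes index `k` from the support.
  set s := μ k / a k with hs
  have hspos : 0 < s := div_pos hμk hak
  have hν : ∀ i, 0 ≤ μ i - s * a i := by
    intro i
    rcases le_or_gt (a i) 0 with h | h
    · nlinarith [hμ i]
    · have h1 := hmin i (by simpa using h)
      have h2 : s ≤ μ i / a i := h1
      rw [le_div_iff₀ h] at h2
      linarith
  have hsub : ∀ i, μ i - s * a i ≠ 0 → μ i ≠ 0 := by
    intro i hi h0
    have : a i = 0 := by
      by_contra h1
      exact hsupp i h1 h0
    exact hi (by simp [h0, this])
  have hk0 : μ k - s * a k = 0 := by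
    rw [hs]
    field_simp
    ring
  obtain ⟨ν, h1, h2, h3, h4⟩ := ih _ (by
    rw [← hc]
    refine Finset.card_lt_card ⟨fun i hi => ?_, fun hss => ?_⟩
    · simp only [Finset.mem_filter, Finset.mem_univ, true_and] at hi ⊢
      exact hsub i hi
    · have : k ∈ Finset.univ.filter fun i => μ i - s * a i ≠ 0 :=
        hss (by simpa using hμk.ne')
      simp [hk0] at this) (fun i => μ i - s * a i) hν rfl
  refine ⟨ν, h1, fun i hi => hsub i (h2 i hi), h3, ?_⟩
  rw [h4]
  simp only [sub_smul, Finset.sum_sub_distrib, mul_smul, ← Finset.smul_sum, hsum, smul_zero,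
    sub_zero]

variable {E κ : Type*} [NormedAddCommGroup E] [InnerProductSpace ℝ E] [Fintype κ]

/-- The coefficients of linear combinations of linearly independent subfamilies of a finite family
are bounded by the combinations. -/
theorem exists_norm_le_of_linearIndepOn (l : κ → E) :
    ∃ C : ℝ, 0 ≤ C ∧ ∀ J : Set κ, LinearIndepOn ℝ l J → ∀ a : κ → ℝ, (∀ k, a k ≠ 0 → k ∈ J) →
      ‖a‖ ≤ C * ‖∑ k, a k • l k‖ := by
  classical
  have hJ : ∀ J : Set κ, ∃ C : ℝ, 0 ≤ C ∧ (LinearIndepOn ℝ l J → ∀ a : κ → ℝ,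
      (∀ k, a k ≠ 0 → k ∈ J) → ‖a‖ ≤ C * ‖∑ k, a k • l k‖) := by
    intro J
    by_cases hind : LinearIndepOn ℝ l J
    swap
    · exact ⟨0, le_rfl, fun h => absurd h hind⟩
    have hker : LinearMap.ker (Fintype.linearCombination ℝ (fun k : J => l k)) = ⊥ :=
      LinearMap.ker_eq_bot.2 (linearIndependent_iff_injective_fintypeLinearCombination.1 hind)
    obtain ⟨K, hK, hanti⟩ := LinearMap.exists_antilipschitzWith _ hker
    refine ⟨K, K.2, fun _ a ha => ?_⟩
    have h1 := hanti.le_mul_dist (fun k : J => a k) 0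
    rw [map_zero, dist_zero_right, dist_zero_right, Fintype.linearCombination_apply] at h1
    have h2 : ∑ k : J, a k • l k = ∑ k, a k • l k := by
      refine Fintype.sum_of_injective Subtype.val Subtype.val_injective _ _ (fun k hk => ?_)
        fun _ => rfl
      have : a k = 0 := by
        by_contra h
        exact hk ⟨⟨k, ha k h⟩, rfl⟩
      rw [this, zero_smul]
    rw [h2] at h1
    refine le_trans ((pi_norm_le_iff_of_nonneg (norm_nonneg _)).2 fun k => ?_) h1
    by_cases hk : k ∈ J
    · exact norm_le_pi_norm (fun k : J => a k) ⟨k, hk⟩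
    · have : a k = 0 := by
        by_contra h
        exact hk (ha k h)
      simp [this]
  choose C hC0 hC using hJ
  -- There are finitely many subfamilies `J`, so the sum of their constants serves them all.
  refine ⟨∑ J, C J, Finset.sum_nonneg fun J _ => hC0 J, fun J hind a ha => ?_⟩
  exact (hC J hind a ha).trans (mul_le_mul_of_nonneg_right
    (Finset.single_le_sum (fun J _ => hC0 J) (Finset.mem_univ J)) (norm_nonneg _))

/-- The cone generated by the vectors `l k`, `k ∈ I`, is closed. -/
theorem isClosed_coneHull (l : κ → E) (I : Set κ) :
    IsClosed {x : E | ∃ a : κ → ℝ, (∀ k, 0 ≤ a k) ∧ (∀ k, a k ≠ 0 → k ∈ I) ∧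
      ∑ k, a k • l k = x} := by
  obtain ⟨C, hC0, hC⟩ := exists_norm_le_of_linearIndepOn l
  -- By Carathéodory the cone is a finite union of cones over independent subfamilies, so it
  -- suffices to close each of these.
  have hunion : {x : E | ∃ a : κ → ℝ, (∀ k, 0 ≤ a k) ∧ (∀ k, a k ≠ 0 → k ∈ I) ∧
      ∑ k, a k • l k = x} = ⋃ J ∈ {J : Set κ | LinearIndepOn ℝ l J ∧ J ⊆ I},
        {x : E | ∃ a : κ → ℝ, (∀ k, 0 ≤ a k) ∧ (∀ k, a k ≠ 0 → k ∈ J) ∧ ∑ k, a k • l k = x} := by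
    ext x
    simp only [Set.mem_ofPred_eq, Set.mem_iUnion, exists_prop]
    constructor
    · rintro ⟨a, ha, hI, rfl⟩
      obtain ⟨ν, h1, h2, h3, h4⟩ := exists_linearIndepOn_nonneg_combination l a ha
      exact ⟨_, ⟨h3, fun k hk => hI k (h2 k hk)⟩, ν, h1, fun _ h => h, h4⟩
    · rintro ⟨J, ⟨_, hJI⟩, a, ha, hJ, rfl⟩
      exact ⟨a, ha, fun k hk => hJI (hJ k hk), rfl⟩
  rw [hunion]
  refine Set.Finite.isClosed_biUnion (Set.toFinite _) fun J hJ => ?_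
  refine isClosed_of_closure_subset fun x hx => ?_
  obtain ⟨y, hy, hyx⟩ := mem_closure_iff_seq_limit.1 hx
  choose a ha haJ hay using hy
  -- Over an independent family the coefficients are controlled by the vector, so convergence of the
  -- vectors forces convergence of the coefficients.
  have hcauchy : CauchySeq a := by
    rw [Metric.cauchySeq_iff']
    intro ε hε
    have hC1 : 0 < C + 1 := by linarith
    obtain ⟨M, hM⟩ := Metric.cauchySeq_iff'.1 hyx.cauchySeq (ε / (C + 1)) (div_pos hε hC1)
    refine ⟨M, fun i hi => ?_⟩
    have h1 := hC J hJ.1 (a i - a M) (fun k hk => by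
      by_contra hkJ
      have h2 : ∀ i, a i k = 0 := fun i => by
        by_contra h
        exact hkJ (haJ i k h)
      simp [h2] at hk)
    have h2 : ∑ k, (a i - a M) k • l k = y i - y M := by
      simp only [Pi.sub_apply, sub_smul, Finset.sum_sub_distrib, hay]
    have h3 := hM i hi
    rw [h2] at h1
    rw [dist_eq_norm] at h3 ⊢
    rw [lt_div_iff₀ hC1] at h3
    nlinarith [norm_nonneg (y i - y M)]
  obtain ⟨a₀, ha₀⟩ := cauchySeq_tendsto_of_complete hcauchy
  have hk : ∀ k, Filter.Tendsto (fun i => a i k) Filter.atTop (nhds (a₀ k)) :=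
    fun k => (tendsto_pi_nhds.1 ha₀) k
  refine ⟨a₀, fun k => ge_of_tendsto' (hk k) fun i => ha i k, fun k hk0 => ?_, ?_⟩
  · by_contra hkJ
    refine hk0 (tendsto_nhds_unique (hk k) ?_)
    have : (fun i => a i k) = fun _ => 0 := by
      funext i
      by_contra h
      exact hkJ (haJ i k h)
    rw [this]
    exact tendsto_const_nhds
  · refine tendsto_nhds_unique ?_ hyx
    have : Filter.Tendsto (fun i => ∑ k, a i k • l k) Filter.atTop (nhds (∑ k, a₀ k • l k)) :=
      tendsto_finsetSum _ fun k _ => (hk k).smul_const (l k)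
    simpa only [hay] using this

end PolyhedralProjection

/-! ### Nearest points in convex sets. -/

section Nearest

variable {E : Type*} [NormedAddCommGroup E]

/-- `v` is a point of `K` nearest to `x`. -/
def IsNearest (K : Set E) (x v : E) : Prop := v ∈ K ∧ ∀ w ∈ K, ‖v - x‖ ^ 2 ≤ ‖w - x‖ ^ 2

theorem IsNearest.norm_sub_le {K : Set E} {x v w : E} (h : IsNearest K x v) (hw : w ∈ K) :
    ‖v - x‖ ≤ ‖w - x‖ :=
  (sq_le_sq₀ (norm_nonneg _) (norm_nonneg _)).1 (h.2 w hw)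

variable [InnerProductSpace ℝ E]

/-- If the inner product `c` were positive, a short move from `v` towards `w` would reduce the
distance to `x`. The step `t = c / (c + ‖w - v‖²)` satisfies `t ≤ 1` and `t ‖w - v‖² < 2c`, which is
what the strict decrease requires. -/
theorem IsNearest.inner_le_zero {K : Set E} (hK : Convex ℝ K) {x v : E} (h : IsNearest K x v)
    {w : E} (hw : w ∈ K) : inner ℝ (x - v) (w - v) ≤ 0 := by
  by_contra! hc
  set c := inner ℝ (x - v) (w - v) with hcdef
  have hN : 0 ≤ ‖w - v‖ ^ 2 := sq_nonneg _
  have hden : 0 < c + ‖w - v‖ ^ 2 := by linarith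
  set t := c / (c + ‖w - v‖ ^ 2) with ht
  have ht0 : 0 < t := div_pos hc hden
  have ht1 : t ≤ 1 := (div_le_one hden).2 (by linarith)
  have hmem := hK h.1 hw (sub_nonneg.2 ht1) ht0.le (by ring)
  have h1 := h.2 _ hmem
  have h2 : (1 - t) • v + t • w - x = (v - x) + t • (w - v) := by
    module
  rw [h2, norm_add_sq_real, inner_smul_right, norm_smul, Real.norm_of_nonneg ht0.le] at h1
  have h3 : inner ℝ (v - x) (w - v) = -c := by
    rw [hcdef, ← inner_neg_left, neg_sub]
  rw [h3] at h1
  have h4 : t * (c + ‖w - v‖ ^ 2) = c := by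
    rw [ht]
    field_simp
  have h5 : 0 ≤ t * (t * ‖w - v‖ ^ 2 - 2 * c) := by nlinarith
  have h6 : 0 ≤ t * ‖w - v‖ ^ 2 - 2 * c := nonneg_of_mul_nonneg_right h5 ht0
  nlinarith

theorem exists_isNearest [FiniteDimensional ℝ E] {K : Set E} (hK : IsClosed K) (hne : K.Nonempty) (x : E) :
    ∃ v, IsNearest K x v := by
  have : ProperSpace E := FiniteDimensional.proper_real E
  obtain ⟨v, hv, hd⟩ := hK.exists_infDist_eq_dist hne x
  refine ⟨v, hv, fun w hw => ?_⟩
  have := Metric.infDist_le_dist_of_mem (x := x) hw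
  rw [hd, dist_comm x, dist_comm x, dist_eq_norm, dist_eq_norm] at this
  gcongr

/-- Nearest-point maps of convex sets are nonexpansive. -/
theorem IsNearest.norm_sub_le_norm_sub {K : Set E} (hK : Convex ℝ K) {x y v w : E}
    (hv : IsNearest K x v) (hw : IsNearest K y w) : ‖v - w‖ ≤ ‖x - y‖ := by
  have h1 := hv.inner_le_zero hK hw.1
  have h2 := hw.inner_le_zero hK hv.1
  have h3 : ‖v - w‖ ^ 2 ≤ inner ℝ (x - y) (v - w) := by
    have h4 : inner ℝ (x - v) (w - v) + inner ℝ (y - w) (v - w) =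
        ‖v - w‖ ^ 2 - inner ℝ (x - y) (v - w) := by
      rw [← real_inner_self_eq_norm_sq, ← neg_sub v w, inner_neg_right]
      simp only [inner_sub_left]
      ring
    linarith
  have h4 := real_inner_le_norm (x - y) (v - w)
  rcases (norm_nonneg (v - w)).eq_or_lt with h | h
  · rw [← h]
    exact norm_nonneg _
  · exact le_of_mul_le_mul_right (by linarith [sq ‖v - w‖]) h

theorem IsNearest.unique {K : Set E} (hK : Convex ℝ K) {x v w : E}
    (hv : IsNearest K x v) (hw : IsNearest K x w) : v = w := by
  have := hv.norm_sub_le_norm_sub hK hw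
  rw [sub_self, norm_zero] at this
  exact sub_eq_zero.1 (norm_le_zero_iff.1 this)

end Nearest

/-! ### Multipliers and dependence of polyhedral projections on the offsets. -/

section Polyhedron

variable {E κ : Type*} [NormedAddCommGroup E] [InnerProductSpace ℝ E]

/-- The polyhedron with normals `l k` and offsets `b k`. -/
def polyhedron (l : κ → E) (b : κ → ℝ) : Set E := {v | ∀ k, inner ℝ (l k) v ≤ b k}

theorem segment_mem_polyhedron {l : κ → E} {b₁ b₂ : κ → ℝ} {v w : E} (hv : v ∈ polyhedron l b₁)
    (hw : w ∈ polyhedron l b₂) {s t : ℝ} (hs : 0 ≤ s) (ht : 0 ≤ t) :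
    s • v + t • w ∈ polyhedron l (s • b₁ + t • b₂) := by
  intro k
  rw [inner_add_right, inner_smul_right, inner_smul_right]
  exact add_le_add (mul_le_mul_of_nonneg_left (hv k) hs) (mul_le_mul_of_nonneg_left (hw k) ht)

theorem convex_polyhedron (l : κ → E) (b : κ → ℝ) : Convex ℝ (polyhedron l b) := by
  intro v hv w hw s t hs ht hst
  have h := segment_mem_polyhedron hv hw hs ht
  rwa [← add_smul, hst, one_smul] at h

theorem isClosed_polyhedron (l : κ → E) (b : κ → ℝ) : IsClosed (polyhedron l b) := by
  have : polyhedron l b = ⋂ k, {v | inner ℝ (l k) v ≤ b k} := by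
    ext
    simp [polyhedron]
  rw [this]
  exact isClosed_iInter fun k => isClosed_le (by fun_prop) continuous_const

variable [Fintype κ]

/-- Karush-Kuhn-Tucker multipliers with linearly independent support for the projection onto a
polyhedron. -/
theorem IsNearest.exists_multiplier [FiniteDimensional ℝ E] {l : κ → E} {b : κ → ℝ} {x v : E}
    (h : IsNearest (polyhedron l b) x v) :
    ∃ a : κ → ℝ, (∀ k, 0 ≤ a k) ∧ (∀ k, a k ≠ 0 → inner ℝ (l k) v = b k) ∧
      LinearIndepOn ℝ l {k | a k ≠ 0} ∧ ∑ k, a k • l k = x - v := by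
  set I : Set κ := {k | inner ℝ (l k) v = b k}
  set K : Set E := {x : E | ∃ a : κ → ℝ, (∀ k, 0 ≤ a k) ∧ (∀ k, a k ≠ 0 → k ∈ I) ∧
      ∑ k, a k • l k = x} with hK
  have hadd : ∀ y ∈ K, ∀ z ∈ K, y + z ∈ K := by
    rintro _ ⟨a, ha, haI, rfl⟩ _ ⟨c, hc, hcI, rfl⟩
    refine ⟨a + c, fun k => add_nonneg (ha k) (hc k), fun k hk => ?_, ?_⟩
    · by_contra hkI
      have h1 : a k = 0 := by
        by_contra h
        exact hkI (haI k h)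
      have h2 : c k = 0 := by
        by_contra h
        exact hkI (hcI k h)
      exact hk (by simp [h1, h2])
    · simp only [Pi.add_apply, add_smul, Finset.sum_add_distrib]
  have hsmul : ∀ t : ℝ, 0 ≤ t → ∀ y ∈ K, t • y ∈ K := by
    rintro t ht _ ⟨a, ha, haI, rfl⟩
    refine ⟨t • a, fun k => mul_nonneg ht (ha k), fun k hk => haI k fun h => hk (by simp [h]), ?_⟩
    simp only [Pi.smul_apply, smul_eq_mul, mul_smul, Finset.smul_sum]
  have hconv : Convex ℝ K := fun y hy z hz s t hs ht _ =>
    hadd _ (hsmul s hs y hy) _ (hsmul t ht z hz)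
  have hzero : (0 : E) ∈ K := ⟨0, fun _ => le_rfl, fun k hk => absurd rfl hk, by simp⟩
  have hgen : ∀ k ∈ I, l k ∈ K := by
    classical
    intro k hk
    refine ⟨Pi.single k 1, fun i => ?_, fun i hi => ?_, ?_⟩
    · by_cases hik : i = k
      · subst hik
        simp
      · simp [hik]
    · by_contra hiI
      have : i ≠ k := fun h => hiI (h ▸ hk)
      exact hi (by simp [this])
    · rw [Finset.sum_eq_single k]
      · simp
      · intro i _ hik
        simp [hik]
      · simp
  -- Farkas by projection: project `x - v` onto the closed cone of active normals. The residual `d`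
  -- has nonpositive inner product with every active normal, hence is a feasible direction at `v`;
  -- optimality of `v` then forces `d = 0`.
  obtain ⟨z, hz⟩ := exists_isNearest (isClosed_coneHull l I) ⟨0, hzero⟩ (x - v)
  have hz' : ∀ w ∈ K, inner ℝ (x - v - z) (w - z) ≤ 0 := fun w hw => hz.inner_le_zero hconv hw
  have hzz : inner ℝ (x - v - z) z = 0 := by
    apply le_antisymm
    · have := hz' ((2 : ℝ) • z) (hsmul 2 zero_le_two z hz.1)
      rwa [two_smul, add_sub_cancel_right] at this
    · have := hz' 0 hzero
      rw [zero_sub, inner_neg_right] at this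
      linarith
  set d := x - v - z with hd
  have hdI : ∀ k ∈ I, inner ℝ (l k) d ≤ 0 := by
    intro k hk
    have := hz' (z + l k) (hadd z hz.1 _ (hgen k hk))
    rwa [add_sub_cancel_left, real_inner_comm] at this
  have hfeas : ∃ t : ℝ, 0 < t ∧ v + t • d ∈ polyhedron l b := by
    have hev : ∀ᶠ t : ℝ in nhdsWithin 0 (Set.Ioi 0), ∀ k, inner ℝ (l k) (v + t • d) ≤ b k := by
      rw [Filter.eventually_all]
      intro k
      by_cases hk : k ∈ I
      · filter_upwards [self_mem_nhdsWithin] with t ht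
        rw [inner_add_right, inner_smul_right]
        have h1 : inner ℝ (l k) v = b k := hk
        have h2 := mul_nonpos_of_nonneg_of_nonpos (le_of_lt ht) (hdI k hk)
        linarith
      · have hlt : inner ℝ (l k) (v + (0 : ℝ) • d) < b k := by
          rw [zero_smul, add_zero]
          exact lt_of_le_of_ne (h.1 k) hk
        have hcont : Continuous fun t : ℝ => inner ℝ (l k) (v + t • d) := by fun_prop
        have := (hcont.tendsto 0).eventually_lt_const hlt
        exact (this.filter_mono nhdsWithin_le_nhds).mono fun t ht => ht.le
    obtain ⟨t, ht, ht0⟩ := (hev.and self_mem_nhdsWithin).exists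
    exact ⟨t, ht0, ht⟩
  obtain ⟨t, ht, hmem⟩ := hfeas
  have h1 := h.inner_le_zero (convex_polyhedron l b) hmem
  rw [add_sub_cancel_left, inner_smul_right] at h1
  have h2 : inner ℝ (x - v) d ≤ 0 := nonpos_of_mul_nonpos_right h1 ht
  have h3 : inner ℝ d d ≤ 0 := by
    have : inner ℝ d d = inner ℝ (x - v) d - inner ℝ d z := by
      rw [real_inner_comm z d]
      nth_rewrite 1 [hd]
      rw [inner_sub_left]
    rw [this, hzz]
    linarith
  have h4 : d = 0 := inner_self_eq_zero.1 (le_antisymm h3 real_inner_self_nonneg)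
  have h5 : z = x - v := by
    rw [hd] at h4
    exact (sub_eq_zero.1 h4).symm
  obtain ⟨a, ha, haI, haz⟩ := hz.1
  obtain ⟨ν, g1, g2, g3, g4⟩ := exists_linearIndepOn_nonneg_combination l a ha
  exact ⟨ν, g1, fun k hk => haI k (g2 k hk), g3, by rw [g4, haz, h5]⟩

/-- Complementary slackness gives `(a₂ - a₁)⟨l, v₁ - v₂⟩ ≤ (a₂ - a₁)(b₁ - b₂)` for each normal. With
merely bounded multipliers this yields Hölder-1/2 continuity; when multiplier differences are
bounded by `‖v₁ - v₂‖`, it yields a Lipschitz bound. -/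
theorem norm_sub_sq_le_of_multipliers {l : κ → E} {b₁ b₂ : κ → ℝ} {x v₁ v₂ : E} {a₁ a₂ : κ → ℝ}
    (hv₁ : v₁ ∈ polyhedron l b₁) (hv₂ : v₂ ∈ polyhedron l b₂)
    (h₁ : ∀ k, 0 ≤ a₁ k) (h₂ : ∀ k, 0 ≤ a₂ k)
    (hc₁ : ∀ k, a₁ k ≠ 0 → inner ℝ (l k) v₁ = b₁ k) (hc₂ : ∀ k, a₂ k ≠ 0 → inner ℝ (l k) v₂ = b₂ k)
    (hs₁ : ∑ k, a₁ k • l k = x - v₁) (hs₂ : ∑ k, a₂ k • l k = x - v₂) :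
    ‖v₁ - v₂‖ ^ 2 ≤ Fintype.card κ * (‖a₁ - a₂‖ * ‖b₁ - b₂‖) := by
  have hsum : v₁ - v₂ = ∑ k, (a₂ k - a₁ k) • l k := by
    simp only [sub_smul, Finset.sum_sub_distrib, hs₁, hs₂]
    abel
  have hterm : ∀ k, (a₂ k - a₁ k) * inner ℝ (l k) (v₁ - v₂) ≤ ‖a₁ - a₂‖ * ‖b₁ - b₂‖ := by
    intro k
    have e₁ : a₁ k * inner ℝ (l k) v₁ = a₁ k * b₁ k := by
      by_cases h : a₁ k = 0
      · simp [h]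
      · rw [hc₁ k h]
    have e₂ : a₂ k * inner ℝ (l k) v₂ = a₂ k * b₂ k := by
      by_cases h : a₂ k = 0
      · simp [h]
      · rw [hc₂ k h]
    have i₁ := mul_le_mul_of_nonneg_left (hv₂ k) (h₁ k)
    have i₂ := mul_le_mul_of_nonneg_left (hv₁ k) (h₂ k)
    have h3 : (a₂ k - a₁ k) * inner ℝ (l k) (v₁ - v₂) ≤ (a₂ k - a₁ k) * (b₁ k - b₂ k) := by
      rw [inner_sub_right]
      nlinarith
    refine h3.trans ((le_abs_self _).trans ?_)
    rw [abs_mul, abs_sub_comm]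
    exact mul_le_mul (norm_le_pi_norm (a₁ - a₂) k) (norm_le_pi_norm (b₁ - b₂) k) (abs_nonneg _)
      (norm_nonneg _)
  calc ‖v₁ - v₂‖ ^ 2 = inner ℝ (v₁ - v₂) (v₁ - v₂) := (real_inner_self_eq_norm_sq _).symm
    _ = ∑ k, (a₂ k - a₁ k) * inner ℝ (l k) (v₁ - v₂) := by
      nth_rewrite 1 [hsum]
      rw [sum_inner]
      exact Finset.sum_congr rfl fun k _ => real_inner_smul_left _ _ _
    _ ≤ ∑ _k : κ, ‖a₁ - a₂‖ * ‖b₁ - b₂‖ := Finset.sum_le_sum fun k _ => hterm k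
    _ = _ := by rw [Finset.sum_const, Finset.card_univ, nsmul_eq_mul]

/-- The projection onto a polyhedron with fixed normals is Lipschitz in the offsets. -/
theorem exists_lipschitz_nearest_polyhedron [FiniteDimensional ℝ E] (l : κ → E) :
    ∃ C : ℝ, 0 ≤ C ∧ ∀ (b₁ b₂ : κ → ℝ) (x v₁ v₂ : E), IsNearest (polyhedron l b₁) x v₁ →
      IsNearest (polyhedron l b₂) x v₂ → ‖v₂ - v₁‖ ≤ C * ‖b₂ - b₁‖ := by
  obtain ⟨C, hC0, hC⟩ := exists_norm_le_of_linearIndepOn l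
  have hcard : (0 : ℝ) ≤ Fintype.card κ := Nat.cast_nonneg _
  refine ⟨Fintype.card κ * C, by positivity, fun b₁ b₂ x v₁ v₂ hv₁ hv₂ => ?_⟩
  -- The offsets are joined by a segment; every polyhedron along it is nonempty, since it contains
  -- the corresponding convex combination of `v₁` and `v₂`.
  set b : ℝ → κ → ℝ := fun t => (1 - t) • b₁ + t • b₂ with hb
  have hbsub : ∀ s t, ‖b s - b t‖ = |s - t| * ‖b₂ - b₁‖ := by
    intro s t
    have : b s - b t = (s - t) • (b₂ - b₁) := by
      simp only [hb]
      module
    rw [this, norm_smul, Real.norm_eq_abs]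
  have hmem : ∀ t ∈ Set.Icc (0 : ℝ) 1, (1 - t) • v₁ + t • v₂ ∈ polyhedron l (b t) := fun t ht =>
    segment_mem_polyhedron hv₁.1 hv₂.1 (sub_nonneg.2 ht.2) ht.1
  have hex : ∀ t : ℝ, ∃ v, t ∈ Set.Icc (0 : ℝ) 1 → IsNearest (polyhedron l (b t)) x v := by
    intro t
    by_cases ht : t ∈ Set.Icc (0 : ℝ) 1
    · obtain ⟨v, hv⟩ := exists_isNearest (isClosed_polyhedron l (b t)) ⟨_, hmem t ht⟩ x
      exact ⟨v, fun _ => hv⟩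
    · exact ⟨0, fun h => absurd h ht⟩
  choose f hf using hex
  have hmul : ∀ t : ℝ, ∃ a : κ → ℝ, t ∈ Set.Icc (0 : ℝ) 1 → (∀ k, 0 ≤ a k) ∧
      (∀ k, a k ≠ 0 → inner ℝ (l k) (f t) = b t k) ∧
      LinearIndepOn ℝ l {k | a k ≠ 0} ∧ ∑ k, a k • l k = x - f t := by
    intro t
    by_cases ht : t ∈ Set.Icc (0 : ℝ) 1
    · obtain ⟨a, ha⟩ := (hf t ht).exists_multiplier
      exact ⟨a, fun _ => ha⟩
    · exact ⟨0, fun h => absurd h ht⟩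
  choose a ha using hmul
  have hsq : ∀ s ∈ Set.Icc (0 : ℝ) 1, ∀ t ∈ Set.Icc (0 : ℝ) 1,
      ‖f s - f t‖ ^ 2 ≤ Fintype.card κ * (‖a s - a t‖ * (|s - t| * ‖b₂ - b₁‖)) := by
    intro s hs t ht
    rw [← hbsub s t]
    exact norm_sub_sq_le_of_multipliers (hf s hs).1 (hf t ht).1 (ha s hs).1 (ha t ht).1
      (ha s hs).2.1 (ha t ht).2.1 (ha s hs).2.2.2 (ha t ht).2.2.2
  set R : ℝ := C * (‖v₁ - x‖ + ‖v₂ - x‖) with hR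
  have hbound : ∀ t ∈ Set.Icc (0 : ℝ) 1, ‖a t‖ ≤ R := by
    intro t ht
    have h1 := hC _ (ha t ht).2.2.1 (a t) fun _ h => h
    rw [(ha t ht).2.2.2, norm_sub_rev] at h1
    refine h1.trans (mul_le_mul_of_nonneg_left (((hf t ht).norm_sub_le (hmem t ht)).trans ?_) hC0)
    have h2 : (1 - t) • v₁ + t • v₂ - x = (1 - t) • (v₁ - x) + t • (v₂ - x) := by module
    rw [h2]
    refine (norm_add_le _ _).trans ?_
    rw [norm_smul, norm_smul, Real.norm_of_nonneg ht.1, Real.norm_of_nonneg (sub_nonneg.2 ht.2)]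
    nlinarith [norm_nonneg (v₁ - x), norm_nonneg (v₂ - x), ht.1, ht.2]
  have hR0 : 0 ≤ R := by positivity
  -- The multipliers are bounded by `R` on the whole segment, so `hsq` already gives Hölder-1/2
  -- continuity, enough for the covering lemma.
  have hcont : ContinuousOn f (Set.Icc 0 1) := by
    intro t ht
    rw [ContinuousWithinAt, tendsto_iff_norm_sub_tendsto_zero]
    have hlim : Filter.Tendsto
        (fun s => √(Fintype.card κ * ((R + R) * (|s - t| * ‖b₂ - b₁‖))))
        (nhdsWithin t (Set.Icc 0 1)) (nhds 0) := by
      have hc : Continuous fun s : ℝ => √(Fintype.card κ * ((R + R) * (|s - t| * ‖b₂ - b₁‖))) := by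
        fun_prop
      have := hc.tendsto t
      simp only [sub_self, abs_zero, zero_mul, mul_zero, Real.sqrt_zero] at this
      exact this.mono_left nhdsWithin_le_nhds
    refine squeeze_zero' (Filter.Eventually.of_forall fun s => norm_nonneg _) ?_ hlim
    filter_upwards [self_mem_nhdsWithin] with s hs
    refine Real.le_sqrt_of_sq_le ((hsq s hs t ht).trans ?_)
    have := (norm_sub_le (a s) (a t)).trans (add_le_add (hbound s hs) (hbound t ht))
    gcongr
  -- The cover is indexed by independent families `J` containing the support of `a t`. Within one
  -- piece, `a s - a t` is supported in `J`, so it is bounded by `C ‖f s - f t‖`, and one factor `‖f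
  -- s - f t‖` cancels from `hsq`.
  have h01 := norm_sub_le_of_finite_cover hcont
    (fun J : Set κ => {t | {k | a t k ≠ 0} ⊆ J ∧ LinearIndepOn ℝ l J})
    (fun t ht => ⟨_, subset_rfl, (ha t ht).2.2.1⟩)
    (C := Fintype.card κ * C * ‖b₂ - b₁‖) (by
      rintro J s ⟨⟨hsJ, hJ⟩, hs⟩ t ⟨⟨htJ, -⟩, ht⟩
      have h1 := hC J hJ (a s - a t) (fun k hk => by
        by_contra hkJ
        have e₁ : a s k = 0 := by
          by_contra h
          exact hkJ (hsJ h)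
        have e₂ : a t k = 0 := by
          by_contra h
          exact hkJ (htJ h)
        exact hk (by simp [e₁, e₂]))
      have h2 : ∑ k, (a s - a t) k • l k = f t - f s := by
        simp only [Pi.sub_apply, sub_smul, Finset.sum_sub_distrib, (ha s hs).2.2.2,
          (ha t ht).2.2.2]
        abel
      rw [h2, norm_sub_rev (f t)] at h1
      have h3 : ‖f s - f t‖ * ‖f s - f t‖ ≤
          Fintype.card κ * C * ‖b₂ - b₁‖ * |s - t| * ‖f s - f t‖ := by
        calc ‖f s - f t‖ * ‖f s - f t‖ = ‖f s - f t‖ ^ 2 := (sq _).symm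
          _ ≤ _ := hsq s hs t ht
          _ ≤ Fintype.card κ * ((C * ‖f s - f t‖) * (|s - t| * ‖b₂ - b₁‖)) := by gcongr
          _ = _ := by ring
      rcases (norm_nonneg (f s - f t)).eq_or_lt with h | h
      · rw [← h]
        positivity
      · exact le_of_mul_le_mul_right h3 h)
  have e0 : f 0 = v₁ := by
    refine (hf 0 (by simp)).unique (convex_polyhedron _ _) ?_
    simpa [hb] using hv₁
  have e1 : f 1 = v₂ := by
    refine (hf 1 (by simp)).unique (convex_polyhedron _ _) ?_
    simpa [hb] using hv₂
  rwa [e0, e1] at h01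

end Polyhedron

/-! ### Existence of admissible designs -/

section PiecewiseLinear

/-- The function with slope `a` on the negative and slope `b` on the positive half-line. -/
def piecewiseLinear (a b t : ℝ) : ℝ := b * max t 0 + a * min t 0

theorem piecewiseLinear_of_nonneg (a b : ℝ) {t : ℝ} (ht : 0 ≤ t) :
    piecewiseLinear a b t = b * t := by
  simp [piecewiseLinear, ht]

theorem piecewiseLinear_of_nonpos (a b : ℝ) {t : ℝ} (ht : t ≤ 0) :
    piecewiseLinear a b t = a * t := by
  simp [piecewiseLinear, ht]

theorem lipschitzWith_piecewiseLinear {a b : ℝ} (ha : 0 ≤ a) (hb : 0 ≤ b) :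
    LipschitzWith (Real.toNNReal (a + b)) (piecewiseLinear a b) := by
  refine LipschitzWith.of_dist_le_mul fun x y => ?_
  rw [Real.coe_toNNReal _ (add_nonneg ha hb), Real.dist_eq, Real.dist_eq]
  have h1 : |max x 0 - max y 0| ≤ |x - y| := abs_max_sub_max_le_abs x y 0
  have h2 : |min x 0 - min y 0| ≤ |x - y| := by
    have := abs_min_sub_min_le_max x 0 y 0
    simpa using this
  calc |piecewiseLinear a b x - piecewiseLinear a b y|
      = |b * (max x 0 - max y 0) + a * (min x 0 - min y 0)| := by
        unfold piecewiseLinear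
        congr 1
        ring
    _ ≤ b * |max x 0 - max y 0| + a * |min x 0 - min y 0| := by
        refine (abs_add_le _ _).trans ?_
        rw [abs_mul, abs_mul, abs_of_nonneg ha, abs_of_nonneg hb]
    _ ≤ b * |x - y| + a * |x - y| := by gcongr
    _ = _ := by ring

theorem isClassKe_piecewiseLinear {a b : ℝ} (ha : 0 < a) (hb : 0 < b) :
    IsClassKe (piecewiseLinear a b) := by
  refine ⟨(lipschitzWith_piecewiseLinear ha.le hb.le).continuous, fun x y hxy => ?_, by
    simp [piecewiseLinear]⟩
  rcases le_total 0 x with hx | hx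
  · rw [piecewiseLinear_of_nonneg a b hx, piecewiseLinear_of_nonneg a b (hx.trans hxy.le)]
    gcongr
  · rw [piecewiseLinear_of_nonpos a b hx]
    rcases le_total 0 y with hy | hy
    · rw [piecewiseLinear_of_nonneg a b hy]
      rcases hx.lt_or_eq with h | h
      · nlinarith
      · subst h
        nlinarith
    · rw [piecewiseLinear_of_nonpos a b hy]
      gcongr

theorem piecewiseLinear_inv {a b : ℝ} (ha : 0 < a) (hb : 0 < b) (t : ℝ) :
    piecewiseLinear a⁻¹ b⁻¹ (piecewiseLinear a b t) = t := by
  rcases le_total 0 t with ht | ht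
  · rw [piecewiseLinear_of_nonneg a b ht, piecewiseLinear_of_nonneg _ _ (by positivity)]
    field_simp
  · rw [piecewiseLinear_of_nonpos a b ht,
      piecewiseLinear_of_nonpos _ _ (mul_nonpos_of_nonneg_of_nonpos ha.le ht)]
    field_simp

/-- `piecewiseLinear` as a bijection of the real line. -/
noncomputable def piecewiseLinearEquiv {a b : ℝ} (ha : 0 < a) (hb : 0 < b) : ℝ ≃ ℝ where
  toFun := piecewiseLinear a b
  invFun := piecewiseLinear a⁻¹ b⁻¹
  left_inv := piecewiseLinear_inv ha hb
  right_inv t := by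
    simpa using piecewiseLinear_inv (inv_pos.2 ha) (inv_pos.2 hb) t

end PiecewiseLinear

/-! ### Room for `c₀` and construction of a design. -/

section DesignExistence

variable {n N : ℕ}

theorem Obstacles.dsMin_le (O : Obstacles n N) (i : Fin N) : O.dsMin ≤ O.ds i :=
  ciInf_le (Set.finite_range _).bddBelow i

theorem Obstacles.le_dsMax (O : Obstacles n N) (i : Fin N) : O.ds i ≤ O.dsMax :=
  le_ciSup (Set.finite_range _).bddAbove i

theorem Obstacles.DistanceCondition.dsMin_pos {O : Obstacles n N} {da db dh : ℝ}
    (hO : O.DistanceCondition da db dh) : 0 < O.dsMin := hO.da_pos.trans hO.da_lt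

theorem Obstacles.DistanceCondition.two_dsMin_lt {O : Obstacles n N} {da db dh : ℝ}
    (hN : 0 < N) (hO : O.DistanceCondition da db dh) : 2 * O.dsMin < 2 * O.dsMax + db := by
  have h1 := O.dsMin_le ⟨0, hN⟩
  have h2 := O.le_dsMax ⟨0, hN⟩
  linarith [hO.db_pos]

theorem Obstacles.DistanceCondition.cStar_pos {O : Obstacles n N} {da db dh : ℝ}
    (hN : 0 < N) (hO : O.DistanceCondition da db dh) : 0 < O.cStar da db := by
  have h1 := hO.two_dsMin_lt hN
  have h2 := hO.dsMin_pos
  have h3 := hO.da_pos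
  have h4 : 0 < 2 * O.dsMax + db := by linarith
  refine div_pos ?_ (by positivity)
  nlinarith [sq_nonneg da]

/-- The left side of `ha3` equals `1 - 2c*`, and the right side is `1 - (1 - k)²/2` with `k =
dr/(vbar - dr)`. So `ha3` is just `c* < ((1 - k)/2)²`. -/
theorem Obstacles.DistanceCondition.two_sqrt_cStar_lt {O : Obstacles n N} {da db dh : ℝ}
    (hN : 0 < N) (hO : O.DistanceCondition da db dh) {vbar dr : ℝ} (hdr : 0 < dr)
    (ha2 : vbar > 2 * dr)
    (ha3 : (2 * O.dsMin ^ 2 - da ^ 2) / (2 * (O.dsMax + db / 2) ^ 2) >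
      1 - (vbar - 2 * dr) ^ 2 / (2 * (vbar - dr) ^ 2)) :
    2 * √(O.cStar da db) + dr / (vbar - dr) < 1 := by
  have hD : 0 < 2 * O.dsMax + db := by linarith [hO.two_dsMin_lt hN, hO.dsMin_pos]
  have hv : 0 < vbar - dr := by linarith
  have hk : (vbar - 2 * dr) / (vbar - dr) = 1 - dr / (vbar - dr) := by
    field_simp
    ring
  have hkpos : 0 < 1 - dr / (vbar - dr) := by
    rw [← hk]
    exact div_pos (by linarith) hv
  have e1 : (2 * O.dsMin ^ 2 - da ^ 2) / (2 * (O.dsMax + db / 2) ^ 2) =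
      1 - 2 * O.cStar da db := by
    have : O.dsMax + db / 2 = (2 * O.dsMax + db) / 2 := by ring
    rw [this, Obstacles.cStar]
    field_simp
    ring
  have e2 : (vbar - 2 * dr) ^ 2 / (2 * (vbar - dr) ^ 2) = (1 - dr / (vbar - dr)) ^ 2 / 2 := by
    rw [← hk]
    field_simp
  rw [e1, e2] at ha3
  have h4 : √(O.cStar da db) < (1 - dr / (vbar - dr)) / 2 := by
    rw [Real.sqrt_lt' (by linarith)]
    nlinarith
  linarith

/-- `α` is linear on each half-line and `φ` is a multiple of `max (c₀ - s) 0`. The slopes are free: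
the positive one is fixed by saturating the speed cap at `db / 2`, the negative one is taken small,
and the factor in `φ` is then taken large. -/
theorem exists_admissible (hN : 0 < N) (O : Obstacles n N) {da db dh : ℝ}
    (hO : O.DistanceCondition da db dh) {vbar dr : ℝ} (hdr : 0 < dr)
    (ha2 : vbar > 2 * dr)
    (ha3 : (2 * O.dsMin ^ 2 - da ^ 2) / (2 * (O.dsMax + db / 2) ^ 2) >
      1 - (vbar - 2 * dr) ^ 2 / (2 * (vbar - dr) ^ 2)) :
    ∃ D : Design, D.Admissible O da db dh vbar dr := by
  have hv : 0 < vbar - dr := by linarith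
  have hc := hO.cStar_pos hN
  have h2c := hO.two_sqrt_cStar_lt hN hdr ha2 ha3
  set x := √(O.cStar da db) with hx
  set k := dr / (vbar - dr) with hk
  set y := √(O.cStar da db + k) with hy
  have hkpos : 0 < k := div_pos hdr hv
  have hxpos : 0 < x := Real.sqrt_pos.2 hc
  have hxsq : x ^ 2 = O.cStar da db := Real.sq_sqrt hc.le
  have hysq : y ^ 2 = O.cStar da db + k := Real.sq_sqrt (by linarith)
  have hypos : 0 < y := Real.sqrt_pos.2 (by linarith)
  have hxy : x + y < 1 := by
    have : y < 1 - x := by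
      rw [hy, Real.sqrt_lt' (by linarith)]
      nlinarith
    linarith
  have hg : 0 < y - x := by
    have : x < y := Real.sqrt_lt_sqrt hc.le (by linarith)
    linarith
  set c₀ := (x + y + 1) / 2 with hc₀
  have hc₀1 : x + y < c₀ := by linarith
  have hc₀pos : 0 < c₀ := by linarith
  have hdrk : dr = k * (vbar - dr) := by
    rw [hk]
    field_simp
  -- Since `c₀ > x + y`, one has `(y - x) c₀ > y² - x² = k`.
  have hgc : dr < (y - x) * (c₀ * (vbar - dr)) := by
    have h1 : k < (y - x) * c₀ := by nlinarith
    have h2 := mul_lt_mul_of_pos_right h1 hv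
    linarith
  have hdb := hO.db_pos
  have hdh := hO.dh_pos
  -- `b` turns `α_upper` into an equality; `a` spends half of the slack in `hgc`, which gives
  -- `α_lower`.
  obtain ⟨b, hb⟩ : ∃ b, b = (vbar - dr + dr / c₀) / (db / 2) := ⟨_, rfl⟩
  obtain ⟨a, ha⟩ : ∃ a, a = ((y - x) * (c₀ * (vbar - dr)) - dr) / (2 * c₀ * dh) := ⟨_, rfl⟩
  have hbpos : 0 < b := by
    rw [hb]
    positivity
  have hapos : 0 < a := by
    rw [ha]
    exact div_pos (by linarith) (by positivity)
  have hbdb : c₀ * (b * (db / 2)) - dr = c₀ * (vbar - dr) := by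
    rw [hb]
    field_simp
    ring
  have hadh : dr + c₀ * (a * dh) < (y - x) * (c₀ * (vbar - dr)) := by
    have : c₀ * (a * dh) = ((y - x) * (c₀ * (vbar - dr)) - dr) / 2 := by
      rw [ha]
      field_simp
    linarith
  -- A Lipschitz constant of the inverse of `α` times the maximal slope of its argument in `c₀ - s`;
  -- the extra `1` makes `φ_large` strict.
  set B := (a⁻¹ + b⁻¹) * (vbar - dr) + 1 with hB
  have hBpos : 0 < B := by positivity
  have hneg : ∀ p, 0 ≤ p → piecewiseLinear a b (-p) = -(a * p) := fun p hp => by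
    rw [piecewiseLinear_of_nonpos a b (by linarith)]
    ring
  refine ⟨⟨c₀, piecewiseLinearEquiv hapos hbpos, fun s => B * max (c₀ - s) 0⟩, ?_⟩
  constructor
  case c₀_pos => exact hc₀pos
  case c₀_lt_one =>
    change c₀ < 1
    linarith
  case α_classKe => exact isClassKe_piecewiseLinear hapos hbpos
  case α_lipschitz => exact ⟨_, lipschitzWith_piecewiseLinear hapos.le hbpos.le⟩
  case α_inv_lipschitz =>
    exact ⟨_, lipschitzWith_piecewiseLinear (inv_pos.2 hapos).le (inv_pos.2 hbpos).le⟩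
  case φ_lipschitz =>
    refine ⟨Real.toNNReal B, LipschitzWith.lipschitzOnWith
      (LipschitzWith.of_dist_le_mul fun s t => ?_)⟩
    rw [Real.coe_toNNReal _ hBpos.le, Real.dist_eq, Real.dist_eq, ← mul_sub, abs_mul,
      abs_of_pos hBpos]
    have h1 := abs_max_sub_max_le_abs (c₀ - s) (c₀ - t) 0
    rw [sub_sub_sub_cancel_left, abs_sub_comm t s] at h1
    gcongr
  case φ_nonneg =>
    intro s _
    change 0 ≤ B * max (c₀ - s) 0
    positivity
  case φ_antitone =>
    intro s _ t _ hst
    change B * max (c₀ - t) 0 ≤ B * max (c₀ - s) 0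
    gcongr
  case c₀_large => exact hc₀1
  case α_upper =>
    change c₀ * (vbar - dr) ≥ c₀ * piecewiseLinear a b (db / 2) - dr
    rw [piecewiseLinear_of_nonneg a b (by positivity), hbdb]
  case α_lower =>
    change c₀ * piecewiseLinear a b (db / 2) - dr > (dr - c₀ * piecewiseLinear a b (-dh)) / (y - x)
    rw [piecewiseLinear_of_nonneg a b (by positivity), hbdb, hneg dh hdh.le, gt_iff_lt,
      div_lt_iff₀ hg]
    linarith
  case φ_zero =>
    intro s hs
    change B * max (c₀ - s) 0 = 0
    rw [max_eq_right (sub_nonpos.2 hs.1), mul_zero]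
  case φ_large =>
    intro s hs p hp K hK
    change B * max (c₀ - s) 0 > piecewiseLinear a⁻¹ b⁻¹ (-K * (s - c₀) / c₀ +
      (-K * (y - x) + dr) / c₀) + p
    have hs0 : 0 < c₀ - s := sub_pos.2 hs.2
    rw [max_eq_left hs0.le]
    have hap : c₀ * (a * p) ≤ c₀ * (a * dh) := by
      have := hp.2
      gcongr
    -- Both admitted values of `K` are at most the speed cap and have `-K g + dr ≤ c₀ α(-p)`; these
    -- two facts are all that is needed.
    have hK' : K ≤ c₀ * (vbar - dr) ∧ -K * (y - x) + dr ≤ c₀ * (-(a * p)) := by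
      rcases hK with h | h
      · refine ⟨h.le, ?_⟩
        have h : K = c₀ * (vbar - dr) := h
        rw [h]
        linarith
      · have h : K = (dr - c₀ * piecewiseLinear a b (-p)) / (y - x) := h
        rw [hneg p hp.1] at h
        have h2 : K * (y - x) = dr - c₀ * -(a * p) := by
          rw [h]
          field_simp
        refine ⟨?_, by linarith⟩
        rw [h, div_le_iff₀ hg]
        linarith
    have hz : -K * (s - c₀) / c₀ + (-K * (y - x) + dr) / c₀ ≤
        piecewiseLinear a b (-p) + (vbar - dr) * (c₀ - s) := by
      rw [hneg p hp.1, ← add_div, div_le_iff₀ hc₀pos]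
      have := mul_le_mul_of_nonneg_right hK'.1 hs0.le
      linarith [hK'.2]
    have hmono := (isClassKe_piecewiseLinear (inv_pos.2 hapos) (inv_pos.2 hbpos)).2.1.monotone hz
    have hlip := (lipschitzWith_piecewiseLinear (inv_pos.2 hapos).le
      (inv_pos.2 hbpos).le).dist_le_mul (piecewiseLinear a b (-p) + (vbar - dr) * (c₀ - s))
      (piecewiseLinear a b (-p))
    rw [piecewiseLinear_inv hapos hbpos, Real.dist_eq, Real.dist_eq, add_sub_cancel_left,
      abs_of_nonneg (by positivity : 0 ≤ (vbar - dr) * (c₀ - s)),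
      Real.coe_toNNReal _ (by positivity)] at hlip
    have := (le_abs_self _).trans hlip
    have hBs : B * (c₀ - s) = (a⁻¹ + b⁻¹) * ((vbar - dr) * (c₀ - s)) + (c₀ - s) := by
      rw [hB]
      ring
    linarith

end DesignExistence

/-! ### The quadratic program of the outer loop -/

section UnitVectors

variable {E : Type*} [NormedAddCommGroup E] [InnerProductSpace ℝ E]

theorem norm_inv_smul_self {a : E} (ha : 0 < ‖a‖) : ‖‖a‖⁻¹ • a‖ = 1 := by
  rw [norm_smul, norm_inv, norm_norm]
  exact inv_mul_cancel₀ ha.ne'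

/-- With `u`, `v` the normalized vectors, `‖a - b‖² = (‖a‖ - ‖b‖)² + ‖a‖‖b‖‖u - v‖²`. -/
theorem mul_norm_normalize_sub_le {a b : E} {ρ : ℝ} (hρ : 0 < ρ) (ha : ρ ≤ ‖a‖) (hb : ρ ≤ ‖b‖) :
    ρ * ‖‖a‖⁻¹ • a - ‖b‖⁻¹ • b‖ ≤ ‖a - b‖ := by
  have ha0 : 0 < ‖a‖ := hρ.trans_le ha
  have hb0 : 0 < ‖b‖ := hρ.trans_le hb
  rw [← sq_le_sq₀ (by positivity) (norm_nonneg _), mul_pow]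
  have h1 : ‖‖a‖⁻¹ • a - ‖b‖⁻¹ • b‖ ^ 2 * (‖a‖ * ‖b‖) = 2 * (‖a‖ * ‖b‖) - 2 * inner ℝ a b := by
    rw [norm_sub_sq_real, norm_inv_smul_self ha0, norm_inv_smul_self hb0, real_inner_smul_left,
      real_inner_smul_right]
    field_simp
    ring
  have h2 : ρ ^ 2 ≤ ‖a‖ * ‖b‖ := by
    rw [sq]
    exact mul_le_mul ha hb hρ.le ha0.le
  have h3 := norm_sub_sq_real a b
  nlinarith [sq_nonneg (‖a‖ - ‖b‖), sq_nonneg (‖‖a‖⁻¹ • a - ‖b‖⁻¹ • b‖),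
    mul_le_mul_of_nonneg_left h2 (sq_nonneg (‖‖a‖⁻¹ • a - ‖b‖⁻¹ • b‖))]

theorem inner_mem_Icc_of_norm_eq_one {a b : E} (ha : ‖a‖ = 1) (hb : ‖b‖ = 1) :
    inner ℝ a b ∈ Set.Icc (-1 : ℝ) 1 := by
  have h := abs_real_inner_le_norm a b
  rw [ha, hb, mul_one] at h
  exact abs_le.1 h

end UnitVectors

theorem abs_ciInf_sub_ciInf_le {ι : Type*} [Finite ι] [Nonempty ι] {f g : ι → ℝ} {C : ℝ}
    (h : ∀ i, |f i - g i| ≤ C) : |(⨅ i, f i) - ⨅ i, g i| ≤ C := by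
  obtain ⟨i, hi⟩ := exists_eq_ciInf_of_finite (f := f)
  obtain ⟨j, hj⟩ := exists_eq_ciInf_of_finite (f := g)
  have h1 : (⨅ i, f i) ≤ f j := ciInf_le (Set.finite_range f).bddBelow j
  have h2 : (⨅ i, g i) ≤ g i := ciInf_le (Set.finite_range g).bddBelow i
  have h3 := abs_le.1 (h i)
  have h4 := abs_le.1 (h j)
  rw [abs_le]
  constructor <;> linarith

/-! ### Feasibility of the quadratic program and Lipschitz dependence of its solution. -/

section OuterLoop

variable {n N m : ℕ} {O : Obstacles n N} {da db dh vbar dr : ℝ} {D : Design}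

/-- A safety tolerance for which the directions to close obstacles stay close to each other. -/
theorem Obstacles.DistanceCondition.exists_tolerance (hN : 0 < N)
    (hO : O.DistanceCondition da db dh) (ha1 : √2 * O.dsMin > da) :
    ∃ Δ > 0, Δ ≤ dh ∧ da ≤ 2 * √(O.cStar da db) * (O.dsMin - Δ) := by
  have hm := hO.dsMin_pos
  have hD := hO.two_dsMin_lt hN
  have hda := hO.da_pos
  have hc := hO.cStar_pos hN
  -- At `Δ = 0` the squared inequality reduces to `(D² - 4m²)(2m² - da²) > 0` with `D = 2 dsMax +
  -- db` and `m = dsMin`; continuity then leaves room for a positive `Δ`.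
  have hlt : da < 2 * √(O.cStar da db) * (O.dsMin - 0) := by
    rw [sub_zero]
    refine lt_of_pow_lt_pow_left₀ 2 (by positivity) ?_
    rw [mul_pow, mul_pow, Real.sq_sqrt hc.le, Obstacles.cStar]
    have h2 : da ^ 2 < 2 * O.dsMin ^ 2 := by
      have := pow_lt_pow_left₀ ha1 hda.le two_ne_zero
      rwa [mul_pow, Real.sq_sqrt zero_le_two] at this
    have hD0 : 0 < (2 * O.dsMax + db) ^ 2 := by
      have : 0 < 2 * O.dsMax + db := by linarith
      positivity
    have hD2 : 4 * O.dsMin ^ 2 < (2 * O.dsMax + db) ^ 2 := by nlinarith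
    have e : 2 ^ 2 * (((2 * O.dsMax + db) ^ 2 - 4 * O.dsMin ^ 2 + 2 * da ^ 2) /
        (2 * (2 * O.dsMax + db) ^ 2)) * O.dsMin ^ 2 =
        2 * ((2 * O.dsMax + db) ^ 2 - 4 * O.dsMin ^ 2 + 2 * da ^ 2) * O.dsMin ^ 2 /
        (2 * O.dsMax + db) ^ 2 := by
      field_simp
    rw [e, lt_div_iff₀ hD0]
    nlinarith [mul_pos (sub_pos.2 hD2) (sub_pos.2 h2)]
  have hcont : Continuous fun Δ : ℝ => 2 * √(O.cStar da db) * (O.dsMin - Δ) := by fun_prop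
  have h1 := ((hcont.tendsto 0).eventually_const_lt hlt).filter_mono
    (nhdsWithin_le_nhds (s := Set.Ioi 0))
  have h2 : ∀ᶠ Δ in nhdsWithin (0 : ℝ) (Set.Ioi 0), Δ ∈ Set.Ioc 0 dh :=
    Ioc_mem_nhdsGT hO.dh_pos
  obtain ⟨Δ, hΔ, hΔ'⟩ := (h1.and h2).exists
  exact ⟨Δ, hΔ'.1, hΔ'.2, hΔ.le⟩

theorem Obstacles.le_norm_of_le_h {Δ : ℝ} {q : EuclideanSpace ℝ (Fin n)} {i : Fin N}
    (h : -Δ ≤ O.h i q) : O.dsMin - Δ ≤ ‖O.pos i - q‖ := by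
  have := O.dsMin_le i
  unfold Obstacles.h at h
  linarith

theorem Obstacles.norm_dir {Δ : ℝ} (hΔ : Δ < O.dsMin) {q : EuclideanSpace ℝ (Fin n)} {i : Fin N}
    (h : -Δ ≤ O.h i q) : ‖O.dir i q‖ = 1 :=
  norm_inv_smul_self ((sub_pos.2 hΔ).trans_le (O.le_norm_of_le_h h))

theorem Obstacles.norm_dir_sub_dir_le {Δ : ℝ} (hΔ : Δ < O.dsMin)
    {q₁ q₂ : EuclideanSpace ℝ (Fin n)} {i : Fin N} (h₁ : -Δ ≤ O.h i q₁) (h₂ : -Δ ≤ O.h i q₂) :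
    (O.dsMin - Δ) * ‖O.dir i q₁ - O.dir i q₂‖ ≤ ‖q₁ - q₂‖ := by
  have h := mul_norm_normalize_sub_le (sub_pos.2 hΔ) (O.le_norm_of_le_h h₁) (O.le_norm_of_le_h h₂)
  rwa [sub_sub_sub_cancel_left, norm_sub_rev q₂] at h

/-- Close obstacles are seen in nearby directions. -/
theorem Obstacles.DistanceCondition.norm_dir_sub_dir_le (hO : O.DistanceCondition da db dh)
    {Δ : ℝ} (hΔ : Δ ≤ dh) (hda : da ≤ 2 * √(O.cStar da db) * (O.dsMin - Δ))
    {q : EuclideanSpace ℝ (Fin n)} (hq : ∀ i, -Δ ≤ O.h i q) {j k : Fin N}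
    (hj : O.h j q ≤ db / 2) (hk : O.h k q ≤ db / 2) :
    ‖O.dir j q - O.dir k q‖ ≤ 2 * √(O.cStar da db) := by
  have hpos : 0 < O.dsMin - Δ := by linarith [hO.dh_lt]
  have h := mul_norm_normalize_sub_le hpos (O.le_norm_of_le_h (hq j)) (O.le_norm_of_le_h (hq k))
  rw [sub_sub_sub_cancel_right] at h
  have h2 := hO.close q (fun i => by linarith [hq i]) j k hj hk
  exact le_of_mul_le_mul_left ((h.trans (h2.trans hda)).trans_eq (mul_comm _ _)) hpos

theorem regDist_le (q l : EuclideanSpace ℝ (Fin n)) (i : Fin N) :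
    regDist O D q l ≤ O.h i q + D.φ (inner ℝ (O.dir i q) l) :=
  ciInf_le (Set.finite_range _).bddBelow i

theorem exists_regDist_eq (hN : 0 < N) (q l : EuclideanSpace ℝ (Fin n)) :
    ∃ i, regDist O D q l = O.h i q + D.φ (inner ℝ (O.dir i q) l) := by
  have : Nonempty (Fin N) := ⟨⟨0, hN⟩⟩
  obtain ⟨i, hi⟩ := exists_eq_ciInf_of_finite
    (f := fun i => ‖O.pos i - q‖ - O.ds i + D.φ (inner ℝ (O.dir i q) l))
  exact ⟨i, hi.symm⟩

/-- If no obstacle is within `db / 2`, zero velocity is feasible. Otherwise one retreats at speed `K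
= (dr - c₀ α(-dh)) / g` from any one close obstacle. By `α_lower` and `α_upper`, `K` is below the
cap and below every bound due to a far obstacle; the bounds due to close ones hold because their
directions are within `2x` of the chosen one. -/
theorem qpFeasible_nonempty (hN : 0 < N) (hO : O.DistanceCondition da db dh) (hdr : 0 < dr)
    (hv : 0 < vbar - dr) (hD : D.Admissible O da db dh vbar dr)
    {l : Fin m → EuclideanSpace ℝ (Fin n)} (hl : ∀ k, ‖l k‖ = 1)
    {Δ : ℝ} (hΔ : Δ ≤ dh) (hda : da ≤ 2 * √(O.cStar da db) * (O.dsMin - Δ))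
    {q : EuclideanSpace ℝ (Fin n)} (hq : ∀ i, -Δ ≤ O.h i q) :
    (qpFeasible O D l vbar dr q).Nonempty := by
  have hlarge := hD.c₀_large
  have hup := hD.α_upper
  have hlow := hD.α_lower
  have hφ := hD.φ_large
  have hc₀ := hD.c₀_pos
  have hdhpos := hO.dh_pos
  have hq' : ∀ i, -dh ≤ O.h i q := fun i => by linarith [hq i]
  have hmono : StrictMono D.α := hD.α_classKe.2.1
  set x := √(O.cStar da db)
  set y := √(O.cStar da db + dr / (vbar - dr))
  have hg : 0 < y - x := by
    have : x < y := Real.sqrt_lt_sqrt (hO.cStar_pos hN).le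
      (lt_add_of_pos_right _ (div_pos hdr hv))
    linarith
  have hα0 : D.α (-dh) < 0 := by
    have := hmono (neg_lt_zero.2 hdhpos)
    rwa [hD.α_classKe.2.2] at this
  obtain ⟨K, hK⟩ : ∃ K, K = (dr - D.c₀ * D.α (-dh)) / (y - x) := ⟨_, rfl⟩
  have hKg : K * (y - x) = dr - D.c₀ * D.α (-dh) := by
    rw [hK]
    field_simp
  have hKpos : 0 < K := by
    rw [hK]
    exact div_pos (by nlinarith) hg
  rw [← hK] at hlow
  have hnd : ∀ i, ‖O.dir i q‖ = 1 := fun i => O.norm_dir hO.dh_lt (hq' i)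
  have hφ0 : ∀ i k, 0 ≤ D.φ (inner ℝ (O.dir i q) (l k)) := fun i k =>
    hD.φ_nonneg _ (inner_mem_Icc_of_norm_eq_one (hnd i) (hl k))
  have hfar : ∀ i k, db / 2 < O.h i q →
      K ≤ D.c₀ * D.α (O.h i q + D.φ (inner ℝ (O.dir i q) (l k))) - dr := by
    intro i k hi
    have h1 : D.α (db / 2) ≤ D.α (O.h i q + D.φ (inner ℝ (O.dir i q) (l k))) :=
      hmono.monotone (by linarith [hφ0 i k])
    have h2 := mul_le_mul_of_nonneg_left h1 hc₀.le
    linarith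
  by_cases hclose : ∃ j, O.h j q ≤ db / 2
  · obtain ⟨j, hj⟩ := hclose
    refine ⟨-(K • O.dir j q), fun k => ?_⟩
    rw [inner_neg_right, inner_smul_right]
    have hI := inner_mem_Icc_of_norm_eq_one (hl k) (hnd j)
    have hle : -(K * inner ℝ (l k) (O.dir j q)) ≤ K := by nlinarith [hI.1]
    refine ⟨?_, by linarith⟩
    obtain ⟨i, hi⟩ := exists_regDist_eq (O := O) (D := D) hN q (l k)
    rw [hi]
    rcases lt_or_ge (db / 2) (O.h i q) with hfi | hci
    · exact hle.trans (hfar i k hfi)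
    set s := inner ℝ (O.dir i q) (l k) with hs
    have hsI : s ∈ Set.Icc (-1 : ℝ) 1 := inner_mem_Icc_of_norm_eq_one (hnd i) (hl k)
    have hsj : s - 2 * x ≤ inner ℝ (l k) (O.dir j q) := by
      have h1 := real_inner_le_norm (O.dir i q - O.dir j q) (l k)
      rw [hl k, mul_one, inner_sub_left, real_inner_comm (l k) (O.dir j q)] at h1
      have h2 := hO.norm_dir_sub_dir_le hΔ hda hq hci hj
      linarith
    have hKs := mul_le_mul_of_nonneg_left hsj hKpos.le
    rcases lt_or_ge s D.c₀ with hsc | hsc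
    -- Taking `p = dh` in `φ_large` bounds the offset below by `-K (s - c₀ + y - x)`, which exceeds
    -- `-K (s - 2x)` precisely because `c₀ > x + y`.
    · have h1 := hφ s ⟨hsI.1, hsc⟩ dh ⟨hdhpos.le, le_rfl⟩ K (Or.inr hK)
      have h2 : -K * (s - D.c₀) / D.c₀ + (-K * (y - x) + dr) / D.c₀ <
          D.α (O.h i q + D.φ s) := by
        rw [← D.α.apply_symm_apply (-K * (s - D.c₀) / D.c₀ + (-K * (y - x) + dr) / D.c₀)]
        exact hmono (by linarith [hq' i])
      rw [← add_div, div_lt_iff₀ hc₀] at h2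
      nlinarith [mul_pos hKpos (sub_pos.2 hlarge)]
    · have h1 : D.α (-dh) ≤ D.α (O.h i q + D.φ s) :=
        hmono.monotone (by linarith [hq' i, hφ0 i k])
      have h2 := mul_le_mul_of_nonneg_left h1 hc₀.le
      nlinarith [mul_pos hKpos (sub_pos.2 hlarge), mul_nonneg hKpos.le (sub_nonneg.2 hsc)]
  · push Not at hclose
    refine ⟨0, fun k => ?_⟩
    rw [inner_zero_right]
    obtain ⟨i, hi⟩ := exists_regDist_eq (O := O) (D := D) hN q (l k)
    rw [hi]
    exact ⟨hKpos.le.trans (hfar i k (hclose i)), by positivity⟩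

/-- The offsets of the quadratic program. -/
noncomputable def qpBound (O : Obstacles n N) (D : Design) (l : Fin m → EuclideanSpace ℝ (Fin n))
    (vbar dr : ℝ) (q : EuclideanSpace ℝ (Fin n)) (k : Fin m) : ℝ :=
  min (D.c₀ * D.α (regDist O D q (l k)) - dr) (D.c₀ * (vbar - dr))

theorem qpFeasible_eq_polyhedron (l : Fin m → EuclideanSpace ℝ (Fin n)) (vbar dr : ℝ)
    (q : EuclideanSpace ℝ (Fin n)) :
    qpFeasible O D l vbar dr q = polyhedron l (qpBound O D l vbar dr q) := by
  ext v
  simp [qpFeasible, polyhedron, qpBound]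

theorem isQPSolution_iff (l : Fin m → EuclideanSpace ℝ (Fin n)) (vbar dr : ℝ)
    (q vc v : EuclideanSpace ℝ (Fin n)) :
    IsQPSolution O D l vbar dr q vc v ↔
      IsNearest (polyhedron l (qpBound O D l vbar dr q)) vc v := by
  rw [← qpFeasible_eq_polyhedron]
  rfl

theorem existsUnique_isQPSolution {l : Fin m → EuclideanSpace ℝ (Fin n)}
    {q : EuclideanSpace ℝ (Fin n)} (h : (qpFeasible O D l vbar dr q).Nonempty)
    (vc : EuclideanSpace ℝ (Fin n)) : ∃! v, IsQPSolution O D l vbar dr q vc v := by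
  simp only [isQPSolution_iff]
  rw [qpFeasible_eq_polyhedron] at h
  obtain ⟨v, hv⟩ := exists_isNearest (isClosed_polyhedron _ _) h vc
  exact ⟨v, hv, fun w hw => hw.unique (convex_polyhedron _ _) hv⟩

theorem isQPSolution_qpMap {l : Fin m → EuclideanSpace ℝ (Fin n)}
    {q : EuclideanSpace ℝ (Fin n)} (h : (qpFeasible O D l vbar dr q).Nonempty)
    (vc : EuclideanSpace ℝ (Fin n)) :
    IsQPSolution O D l vbar dr q vc (qpMap O D l vbar dr q vc) :=
  Classical.epsilon_spec (existsUnique_isQPSolution h vc).exists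

theorem exists_abs_regDist_sub_le (hN : 0 < N) (hO : O.DistanceCondition da db dh)
    (hD : D.Admissible O da db dh vbar dr) :
    ∃ C : ℝ, 0 ≤ C ∧ ∀ q₁ q₂ : EuclideanSpace ℝ (Fin n), (∀ i, -dh ≤ O.h i q₁) →
      (∀ i, -dh ≤ O.h i q₂) → ∀ l : EuclideanSpace ℝ (Fin n), ‖l‖ = 1 →
      |regDist O D q₁ l - regDist O D q₂ l| ≤ C * ‖q₁ - q₂‖ := by
  have : Nonempty (Fin N) := ⟨⟨0, hN⟩⟩
  obtain ⟨Kφ, hφ⟩ := hD.φ_lipschitz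
  have hρ : 0 < O.dsMin - dh := sub_pos.2 hO.dh_lt
  refine ⟨1 + Kφ / (O.dsMin - dh), by positivity, fun q₁ q₂ h₁ h₂ l hl => ?_⟩
  refine abs_ciInf_sub_ciInf_le fun i => ?_
  have e1 : |‖O.pos i - q₁‖ - ‖O.pos i - q₂‖| ≤ ‖q₁ - q₂‖ := by
    have := abs_norm_sub_norm_le (O.pos i - q₁) (O.pos i - q₂)
    rwa [sub_sub_sub_cancel_left, norm_sub_rev q₂] at this
  have e2 := hφ.dist_le_mul _
    (inner_mem_Icc_of_norm_eq_one (O.norm_dir hO.dh_lt (h₁ i)) hl) _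
    (inner_mem_Icc_of_norm_eq_one (O.norm_dir hO.dh_lt (h₂ i)) hl)
  rw [Real.dist_eq, Real.dist_eq, ← inner_sub_left] at e2
  have e3 : |inner ℝ (O.dir i q₁ - O.dir i q₂) l| ≤ ‖q₁ - q₂‖ / (O.dsMin - dh) := by
    refine (abs_real_inner_le_norm _ _).trans ?_
    rw [hl, mul_one, le_div_iff₀ hρ, mul_comm]
    exact O.norm_dir_sub_dir_le hO.dh_lt (h₁ i) (h₂ i)
  have e4 := mul_le_mul_of_nonneg_left e3 Kφ.2
  have e5 : (Kφ : ℝ) * (‖q₁ - q₂‖ / (O.dsMin - dh)) = Kφ / (O.dsMin - dh) * ‖q₁ - q₂‖ := by ring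
  calc |‖O.pos i - q₁‖ - O.ds i + D.φ (inner ℝ (O.dir i q₁) l) -
        (‖O.pos i - q₂‖ - O.ds i + D.φ (inner ℝ (O.dir i q₂) l))|
      = |(‖O.pos i - q₁‖ - ‖O.pos i - q₂‖) + (D.φ (inner ℝ (O.dir i q₁) l) -
        D.φ (inner ℝ (O.dir i q₂) l))| := by
        congr 1
        ring
    _ ≤ _ := abs_add_le _ _
    _ ≤ ‖q₁ - q₂‖ + Kφ / (O.dsMin - dh) * ‖q₁ - q₂‖ :=
        add_le_add e1 ((e2.trans e4).trans_eq e5)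
    _ = _ := by ring

theorem exists_norm_qpBound_sub_le (hN : 0 < N) (hO : O.DistanceCondition da db dh)
    (hD : D.Admissible O da db dh vbar dr) {l : Fin m → EuclideanSpace ℝ (Fin n)}
    (hl : ∀ k, ‖l k‖ = 1) :
    ∃ C : ℝ, 0 ≤ C ∧ ∀ q₁ q₂ : EuclideanSpace ℝ (Fin n), (∀ i, -dh ≤ O.h i q₁) →
      (∀ i, -dh ≤ O.h i q₂) →
      ‖qpBound O D l vbar dr q₁ - qpBound O D l vbar dr q₂‖ ≤ C * ‖q₁ - q₂‖ := by
  obtain ⟨C, hC0, hC⟩ := exists_abs_regDist_sub_le hN hO hD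
  obtain ⟨K, hK⟩ := hD.α_lipschitz
  have hc₀ := hD.c₀_pos
  refine ⟨D.c₀ * (K * C), by positivity, fun q₁ q₂ h₁ h₂ => ?_⟩
  refine (pi_norm_le_iff_of_nonneg (by positivity)).2 fun k => ?_
  rw [Pi.sub_apply, Real.norm_eq_abs]
  have h := abs_min_sub_min_le_max (D.c₀ * D.α (regDist O D q₁ (l k)) - dr)
    (D.c₀ * (vbar - dr)) (D.c₀ * D.α (regDist O D q₂ (l k)) - dr) (D.c₀ * (vbar - dr))
  rw [sub_self, abs_zero, max_eq_left (abs_nonneg _), sub_sub_sub_cancel_right, ← mul_sub,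
    abs_mul, abs_of_pos hc₀] at h
  refine h.trans ?_
  have h1 := hK.dist_le_mul (regDist O D q₁ (l k)) (regDist O D q₂ (l k))
  rw [Real.dist_eq, Real.dist_eq] at h1
  have h2 := mul_le_mul_of_nonneg_left (hC q₁ q₂ h₁ h₂ (l k) (hl k)) K.2
  have h3 := mul_le_mul_of_nonneg_left (h1.trans h2) hc₀.le
  refine h3.trans_eq ?_
  change D.c₀ * ((K : ℝ) * (C * ‖q₁ - q₂‖)) = _
  ring

/-- The comparison passes through the solution at `(q₂, vc₁)`: changing `q` acts through the offsets
only, and changing `vc` is nonexpansive, whence the summand `1`. -/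
theorem exists_outerLipschitz (hN : 0 < N) (hO : O.DistanceCondition da db dh)
    (hD : D.Admissible O da db dh vbar dr) {l : Fin m → EuclideanSpace ℝ (Fin n)}
    (hl : ∀ k, ‖l k‖ = 1) {Δ : ℝ} (hΔ : Δ ≤ dh)
    (hne : ∀ q, (∀ i, -Δ ≤ O.h i q) → (qpFeasible O D l vbar dr q).Nonempty) :
    ∃ L > 0, OuterLipschitz O (qpMap O D l vbar dr) Δ L := by
  obtain ⟨C, hC0, hC⟩ := exists_lipschitz_nearest_polyhedron l
  obtain ⟨B, hB0, hB⟩ := exists_norm_qpBound_sub_le hN hO hD hl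
  refine ⟨C * B + 1, by positivity, fun q₁ q₂ vc₁ vc₂ hq => ?_⟩
  have h₁ : ∀ i, -Δ ≤ O.h i q₁ := fun i => (hq i).trans (min_le_left _ _)
  have h₂ : ∀ i, -Δ ≤ O.h i q₂ := fun i => (hq i).trans (min_le_right _ _)
  have s₁ := (isQPSolution_iff ..).1 (isQPSolution_qpMap (hne q₁ h₁) vc₁)
  have s₂ := (isQPSolution_iff ..).1 (isQPSolution_qpMap (hne q₂ h₂) vc₂)
  have s₃ := (isQPSolution_iff ..).1 (isQPSolution_qpMap (hne q₂ h₂) vc₁)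
  have e₁ := hC _ _ _ _ _ s₃ s₁
  have e₂ := s₃.norm_sub_le_norm_sub (convex_polyhedron _ _) s₂
  have e₃ := hB q₁ q₂ (fun i => by linarith [h₁ i]) (fun i => by linarith [h₂ i])
  have e₄ := mul_le_mul_of_nonneg_left e₃ hC0
  refine (norm_sub_le_norm_sub_add_norm_sub _ (qpMap O D l vbar dr q₂ vc₁) _).trans ?_
  have h5 : 0 ≤ C * B * ‖vc₁ - vc₂‖ := by positivity
  nlinarith [norm_nonneg (q₁ - q₂)]

end OuterLoop

/-! ### Upper bounds for Clarke's generalized directional derivative -/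

section Clarke

variable {X : Type*} [NormedAddCommGroup X]

theorem eventually_pos_prod (x : X) :
    ∀ᶠ p : X × ℝ in nhds x ×ˢ nhdsWithin (0 : ℝ) (Set.Ioi 0), 0 < p.2 :=
  Filter.tendsto_snd.eventually self_mem_nhdsWithin

theorem tendsto_fst_nhds (x : X) :
    Filter.Tendsto (fun p : X × ℝ => p.1) (nhds x ×ˢ nhdsWithin (0 : ℝ) (Set.Ioi 0)) (nhds x) :=
  Filter.tendsto_fst

variable [NormedSpace ℝ X]

/-- The difference quotients of `f` near `x` in the direction `v` are asymptotically at
most `c`. -/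
def ClarkeRateLE (f : X → ℝ) (x v : X) (c : ℝ) : Prop :=
  ∀ c' > c, ∀ᶠ p : X × ℝ in nhds x ×ˢ nhdsWithin (0 : ℝ) (Set.Ioi 0),
    f (p.1 + p.2 • v) - f p.1 ≤ c' * p.2

theorem tendsto_add_smul_nhds (x v : X) :
    Filter.Tendsto (fun p : X × ℝ => p.1 + p.2 • v)
      (nhds x ×ˢ nhdsWithin (0 : ℝ) (Set.Ioi 0)) (nhds x) := by
  have h1 : Filter.Tendsto (fun p : X × ℝ => p.2)
      (nhds x ×ˢ nhdsWithin (0 : ℝ) (Set.Ioi 0)) (nhds 0) :=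
    Filter.tendsto_snd.mono_right nhdsWithin_le_nhds
  simpa using (tendsto_fst_nhds x).add (h1.smul_const v)

/-- A rate bound in the single direction of the closed-loop motion suffices for the whole
generalized gradient. -/
theorem ClarkeRateLE.apply_le {f : X → ℝ} {x v : X} {c : ℝ} (h : ClarkeRateLE f x v c)
    {δ : X →L[ℝ] ℝ} (hδ : δ ∈ clarkeGradient f x) : δ v ≤ c := by
  refine le_of_forall_gt_imp_ge_of_dense fun c' hc' => ?_
  have h1 : clarkeDirDeriv f x v ≤ (c' : EReal) := by
    refine Filter.limsup_le_of_le (by isBoundedDefault) ?_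
    filter_upwards [h c' hc', eventually_pos_prod x] with p hp hpos
    rw [EReal.coe_le_coe_iff, div_le_iff₀ hpos]
    exact hp
  exact EReal.coe_le_coe_iff.1 ((hδ v).trans h1)

theorem ClarkeRateLE.of_tendsto {f : X → ℝ} {x v : X} {c : ℝ} {G : X × ℝ → ℝ}
    (hG : Filter.Tendsto G (nhds x ×ˢ nhdsWithin (0 : ℝ) (Set.Ioi 0)) (nhds c))
    (hf : ∀ᶠ p : X × ℝ in nhds x ×ˢ nhdsWithin (0 : ℝ) (Set.Ioi 0),
      f (p.1 + p.2 • v) - f p.1 ≤ G p * p.2) : ClarkeRateLE f x v c := by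
  intro c' hc'
  filter_upwards [hf, hG.eventually_lt_const hc', eventually_pos_prod x] with p h1 h2 h3
  exact h1.trans (mul_le_mul_of_nonneg_right h2.le h3.le)

theorem ClarkeRateLE.const_add {f : X → ℝ} {x v : X} {c : ℝ} (h : ClarkeRateLE f x v c) (r : ℝ) :
    ClarkeRateLE (fun y => r + f y) x v c := by
  intro c' hc'
  filter_upwards [h c' hc'] with p hp
  rwa [add_sub_add_left_eq_sub]

theorem ClarkeRateLE.mono {f : X → ℝ} {x v : X} {c c' : ℝ} (h : ClarkeRateLE f x v c)
    (hc : c ≤ c') : ClarkeRateLE f x v c' :=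
  fun d hd => h d (hc.trans_lt hd)

/-- For a finite maximum only the active functions matter. -/
theorem ClarkeRateLE.of_max {ι : Type*} [Finite ι] {F : ι → X → ℝ} {W : X → ℝ} {x v : X} {c : ℝ}
    (hle : ∀ i y, F i y ≤ W y) (hex : ∀ y, ∃ i, W y = F i y) (hcont : ∀ i, ContinuousAt (F i) x)
    (hact : ∀ i, F i x = W x → ClarkeRateLE (F i) x v c) : ClarkeRateLE W x v c := by
  intro c' hc'
  obtain ⟨j, hj⟩ := hex x
  have hinact : ∀ᶠ y in nhds x, ∀ i, F i x ≠ W x → F i y < F j y := by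
    rw [Filter.eventually_all]
    intro i
    by_cases hi : F i x = W x
    · exact Filter.Eventually.of_forall fun y h => absurd hi h
    · have hlt : F i x < F j x := by
        rw [← hj]
        exact lt_of_le_of_ne (hle i x) hi
      exact ((hcont i).eventually_lt (hcont j) hlt).mono fun y hy _ => hy
  have hrate : ∀ᶠ p : X × ℝ in nhds x ×ˢ nhdsWithin (0 : ℝ) (Set.Ioi 0), ∀ i, F i x = W x →
      F i (p.1 + p.2 • v) - F i p.1 ≤ c' * p.2 := by
    rw [Filter.eventually_all]
    intro i
    by_cases hi : F i x = W x
    · exact (hact i hi c' hc').mono fun p hp _ => hp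
    · exact Filter.Eventually.of_forall fun p h => absurd h hi
  -- The index attaining `W` at the displaced point must be active at `x`; at the base point its
  -- function is at most `W`, so its rate dominates that of `W`.
  filter_upwards [hrate, (tendsto_add_smul_nhds x v).eventually hinact] with p h1 h2
  obtain ⟨i, hi⟩ := hex (p.1 + p.2 • v)
  have hiW : F i x = W x := by
    by_contra h
    have := h2 i h
    have := hle j (p.1 + p.2 • v)
    linarith
  have := h1 i hiW
  have := hle i p.1
  linarith

/-- Rate of `z ↦ G (z₁, z₂ - ψ (z₁, z₃))` for a strictly differentiable `G` and a Lipschitz `ψ`. -/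
theorem ClarkeRateLE.of_hasStrictFDerivAt_error {E : Type*} [NormedAddCommGroup E] [NormedSpace ℝ E]
    {ψ : E → E → E} {q qd vc : E} {L : ℝ} (hL : 0 ≤ L)
    (hψ : ∃ U ∈ nhds q, ∀ q₁ ∈ U, ∀ q₂ ∈ U, ∀ v₁ v₂, ‖ψ q₁ v₁ - ψ q₂ v₂‖ ≤
      L * (‖q₁ - q₂‖ + ‖v₁ - v₂‖))
    {G : E × E → ℝ} {G' : E × E →L[ℝ] ℝ} (hG : HasStrictFDerivAt G G' (q, qd - ψ q vc))
    {M : ℝ} (hM : ∀ d, G' (0, d) ≤ M * ‖d‖) (hM0 : 0 ≤ M) (a b w : E) :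
    ClarkeRateLE (fun y : E × E × E => G (y.1, y.2.1 - ψ y.1 y.2.2)) (q, qd, vc) (a, b, w)
      (G' (a, b) + M * (L * (‖a‖ + ‖w‖))) := by
  obtain ⟨U, hU, hLip⟩ := hψ
  have hfst : ∀ᶠ y : E × E × E in nhds (q, qd, vc), y.1 ∈ U :=
    continuousAt_fst.eventually hU
  have hψc : Filter.Tendsto (fun y : E × E × E => ψ y.1 y.2.2) (nhds (q, qd, vc))
      (nhds (ψ q vc)) := by
    rw [tendsto_iff_norm_sub_tendsto_zero]
    have hlim : Filter.Tendsto (fun y : E × E × E => L * (‖y.1 - q‖ + ‖y.2.2 - vc‖))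
        (nhds (q, qd, vc)) (nhds 0) := by
      have hc : Continuous fun y : E × E × E => L * (‖y.1 - q‖ + ‖y.2.2 - vc‖) := by fun_prop
      have := hc.tendsto (q, qd, vc)
      simpa using this
    refine squeeze_zero' (Filter.Eventually.of_forall fun _ => norm_nonneg _) ?_ hlim
    filter_upwards [hfst] with y hy
    exact hLip _ hy _ (mem_of_mem_nhds hU) _ _
  have hz : Filter.Tendsto (fun y : E × E × E => (y.1, y.2.1 - ψ y.1 y.2.2)) (nhds (q, qd, vc))
      (nhds (q, qd - ψ q vc)) := by
    have h1 : Filter.Tendsto (fun y : E × E × E => y.1) (nhds (q, qd, vc)) (nhds q) :=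
      continuous_fst.tendsto _
    have h2 : Filter.Tendsto (fun y : E × E × E => y.2.1) (nhds (q, qd, vc)) (nhds qd) :=
      (continuous_fst.comp continuous_snd).tendsto (q, qd, vc)
    exact h1.prodMk_nhds (h2.sub hψc)
  intro c' hc'
  set R := L * (‖a‖ + ‖w‖) with hR
  have hR0 : 0 ≤ R := by positivity
  set B := ‖a‖ + ‖b‖ + R with hB
  have hB0 : 0 ≤ B := by positivity
  set c := G' (a, b) + M * R with hc
  -- `t * B` bounds the displacement of the argument of `G` for step `t`, so this tolerance turns
  -- the linearization error into at most `(c' - c) t`.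
  have hη : 0 < (c' - c) / (B + 1) := div_pos (sub_pos.2 hc') (by linarith)
  have hηB : (c' - c) / (B + 1) * B ≤ c' - c := by
    rw [div_mul_eq_mul_div, div_le_iff₀ (by linarith)]
    nlinarith [sub_pos.2 hc']
  have hadd := tendsto_add_smul_nhds (q, qd, vc) (a, b, w)
  have hid := tendsto_fst_nhds (q, qd, vc)
  -- Strict differentiability is needed because both endpoints of the difference quotient move.
  have hlittle := ((hz.comp hadd).prodMk_nhds (hz.comp hid)).eventually (hG.isLittleO.def hη)
  filter_upwards [hlittle, hadd.eventually hfst, hid.eventually hfst,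
    eventually_pos_prod (q, qd, vc)] with p h1 h2 h3 h4
  obtain ⟨⟨y₁, y₂, y₃⟩, t⟩ := p
  simp only [Function.comp_apply, Prod.fst_add, Prod.snd_add, Prod.smul_fst, Prod.smul_snd,
    Prod.mk_sub_mk] at h1 h2 h3 h4 ⊢
  set d := ψ (y₁ + t • a) (y₃ + t • w) - ψ y₁ y₃ with hd
  have hdn : ‖d‖ ≤ t * R := by
    have := hLip _ h2 _ h3 (y₃ + t • w) y₃
    rw [add_sub_cancel_left, add_sub_cancel_left, norm_smul, norm_smul,
      Real.norm_of_nonneg h4.le] at this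
    rw [hR]
    linarith
  have e1 : y₁ + t • a - y₁ = t • a := add_sub_cancel_left _ _
  have e2 : y₂ + t • b - ψ (y₁ + t • a) (y₃ + t • w) - (y₂ - ψ y₁ y₃) = t • b - d := by
    rw [hd]
    abel
  rw [e1, e2] at h1
  have e3 : G' (t • a, t • b - d) = t * G' (a, b) + G' (0, -d) := by
    rw [← smul_eq_mul, ← map_smul, ← map_add]
    congr 1
    simp [sub_eq_add_neg]
  have hn : ‖(t • a, t • b - d)‖ ≤ t * B := by
    rw [Prod.norm_mk, max_le_iff]
    constructor
    · rw [norm_smul, Real.norm_of_nonneg h4.le]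
      exact mul_le_mul_of_nonneg_left (by rw [hB]; linarith [norm_nonneg b]) h4.le
    · refine (norm_sub_le _ _).trans ?_
      rw [norm_smul, Real.norm_of_nonneg h4.le, hB]
      nlinarith [mul_nonneg h4.le (norm_nonneg a)]
  have h5 := (le_abs_self _).trans h1
  rw [e3] at h5
  have h6 := hM (-d)
  rw [norm_neg] at h6
  have h7 := mul_le_mul_of_nonneg_left hdn hM0
  have h8 := mul_le_mul_of_nonneg_left hn hη.le
  have h9 := mul_le_mul_of_nonneg_right hηB h4.le
  have h10 : (c' - c) / (B + 1) * (t * B) = (c' - c) / (B + 1) * B * t := by ring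
  have h11 : (c' - c) * t = c' * t - t * G' (a, b) - M * (t * R) := by
    rw [hc]
    ring
  linarith

end Clarke

/-! ### The tracking error energy -/

section Matrices

variable {n : ℕ}

theorem inner_toEuclideanLin (A : Matrix (Fin n) (Fin n) ℝ) (x y : EuclideanSpace ℝ (Fin n)) :
    inner ℝ x (A.toEuclideanLin y) = x.ofLp ⬝ᵥ A *ᵥ y.ofLp := by
  rw [EuclideanSpace.inner_eq_star_dotProduct, star_trivial, dotProduct_comm]
  rfl

theorem inner_toEuclideanLin_transpose (A : Matrix (Fin n) (Fin n) ℝ)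
    (x y : EuclideanSpace ℝ (Fin n)) :
    inner ℝ x (Aᵀ.toEuclideanLin y) = inner ℝ y (A.toEuclideanLin x) := by
  rw [inner_toEuclideanLin, inner_toEuclideanLin, Matrix.mulVec_transpose, dotProduct_comm,
    Matrix.dotProduct_mulVec]

/-- Polarization with `y` the multiple of `T x` of norm `‖x‖`: the form at `x - y` is discarded as
nonnegative, and `‖x + y‖ ≤ 2‖x‖`. -/
theorem norm_apply_le_of_quadratic_le {E : Type*} [NormedAddCommGroup E] [InnerProductSpace ℝ E]
    (T : E →ₗ[ℝ] E) (hsymm : ∀ x y, inner ℝ x (T y) = inner ℝ y (T x))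
    (h0 : ∀ x, 0 ≤ inner ℝ x (T x)) {μ : ℝ} (hμ : ∀ x, inner ℝ x (T x) ≤ μ * ‖x‖ ^ 2) (hμ0 : 0 ≤ μ)
    (x : E) : ‖T x‖ ≤ μ * ‖x‖ := by
  rcases eq_or_ne (T x) 0 with h | h
  · rw [h, norm_zero]
    positivity
  have hu : 0 < ‖T x‖ := norm_pos_iff.2 h
  have hx : 0 < ‖x‖ := by
    rw [norm_pos_iff]
    rintro rfl
    exact h (map_zero T)
  set y := (‖x‖ / ‖T x‖) • T x with hy
  have hyn : ‖y‖ = ‖x‖ := by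
    rw [hy, norm_smul, Real.norm_of_nonneg (by positivity)]
    field_simp
  have hxy : inner ℝ y (T x) = ‖x‖ * ‖T x‖ := by
    rw [hy, real_inner_smul_left, real_inner_self_eq_norm_sq]
    field_simp
  have h1 : 4 * inner ℝ y (T x) = inner ℝ (x + y) (T (x + y)) - inner ℝ (x - y) (T (x - y)) := by
    simp only [map_add, map_sub, inner_add_left, inner_add_right, inner_sub_left, inner_sub_right,
      hsymm x y]
    ring
  have h2 := hμ (x + y)
  have h3 := h0 (x - y)
  have h4 : ‖x + y‖ ^ 2 ≤ (2 * ‖x‖) ^ 2 := by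
    have := norm_add_le x y
    rw [hyn] at this
    exact pow_le_pow_left₀ (norm_nonneg _) (by linarith) 2
  have h5 := mul_le_mul_of_nonneg_left h4 hμ0
  rw [hxy] at h1
  have h6 : ‖x‖ * ‖T x‖ ≤ ‖x‖ * (μ * ‖x‖) := by nlinarith
  exact le_of_mul_le_mul_left h6 hx

end Matrices

namespace ELSystem

variable {n : ℕ} {S : ELSystem n} {μ₁ μ₂ : ℝ}

theorem Standing.le_inner (hS : S.Standing μ₁ μ₂) (q x : EuclideanSpace ℝ (Fin n)) :
    μ₁ * ‖x‖ ^ 2 ≤ inner ℝ x ((S.M q).toEuclideanLin x) := by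
  have h := (hS.lower q).posSemidef.dotProduct_mulVec_nonneg x.ofLp
  rw [star_trivial, ← inner_toEuclideanLin, map_sub, map_smul] at h
  simp only [LinearMap.sub_apply, LinearMap.smul_apply, inner_sub_right, inner_smul_right] at h
  have h1 : (1 : Matrix (Fin n) (Fin n) ℝ).toEuclideanLin x = x := by
    simp
  rw [h1, real_inner_self_eq_norm_sq] at h
  linarith

theorem Standing.inner_le (hS : S.Standing μ₁ μ₂) (q x : EuclideanSpace ℝ (Fin n)) :
    inner ℝ x ((S.M q).toEuclideanLin x) ≤ μ₂ * ‖x‖ ^ 2 := by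
  have h := (hS.upper q).posSemidef.dotProduct_mulVec_nonneg x.ofLp
  rw [star_trivial, ← inner_toEuclideanLin, map_sub, map_smul] at h
  simp only [LinearMap.sub_apply, LinearMap.smul_apply, inner_sub_right, inner_smul_right] at h
  have h1 : (1 : Matrix (Fin n) (Fin n) ℝ).toEuclideanLin x = x := by
    simp
  rw [h1, real_inner_self_eq_norm_sq] at h
  linarith

theorem Standing.inner_comm (hS : S.Standing μ₁ μ₂) (q x y : EuclideanSpace ℝ (Fin n)) :
    inner ℝ x ((S.M q).toEuclideanLin y) = inner ℝ y ((S.M q).toEuclideanLin x) := by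
  rw [← inner_toEuclideanLin_transpose, (hS.symm q).eq]

theorem Standing.norm_le (hS : S.Standing μ₁ μ₂) (q x : EuclideanSpace ℝ (Fin n)) :
    ‖(S.M q).toEuclideanLin x‖ ≤ μ₂ * ‖x‖ :=
  norm_apply_le_of_quadratic_le _ (hS.inner_comm q)
    (fun x => (mul_nonneg hS.lower_pos.le (sq_nonneg _)).trans (hS.le_inner q x))
    (hS.inner_le q) hS.upper_pos.le x

/-- A skew-symmetric matrix has zero quadratic form. This identity cancels the Coriolis term in the
energy balance. -/
theorem Standing.inner_Mdot (hS : S.Standing μ₁ μ₂) (q qd x : EuclideanSpace ℝ (Fin n)) :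
    inner ℝ x ((S.Mdot q qd).toEuclideanLin x) = 2 * inner ℝ x ((S.C q qd).toEuclideanLin x) := by
  have h := congrArg (fun A => inner ℝ x (Matrix.toEuclideanLin (𝕜 := ℝ) A x)) (hS.skew q qd)
  simp only [map_add, map_zero, LinearMap.add_apply, LinearMap.zero_apply, inner_add_right,
    inner_zero_right, inner_toEuclideanLin_transpose] at h
  simp only [map_sub, map_smul, LinearMap.sub_apply, LinearMap.smul_apply, inner_sub_right,
    inner_smul_right] at h
  linarith

/-- The derivative of `q ↦ M(q)` as an operator-valued map. -/
theorem Standing.exists_hasStrictFDerivAt (hS : S.Standing μ₁ μ₂) (q : EuclideanSpace ℝ (Fin n)) :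
    ∃ M' : EuclideanSpace ℝ (Fin n) →L[ℝ]
        EuclideanSpace ℝ (Fin n) →L[ℝ] EuclideanSpace ℝ (Fin n),
      HasStrictFDerivAt (fun q => Matrix.toEuclideanCLM (𝕜 := ℝ) (S.M q)) M' q ∧
      ∀ qd, M' qd = Matrix.toEuclideanCLM (𝕜 := ℝ) (S.Mdot q qd) := by
  -- Expanding in matrix units reduces operator-valued differentiation to the entries of `M`.
  have hsum : ∀ A : Matrix (Fin n) (Fin n) ℝ, Matrix.toEuclideanCLM (𝕜 := ℝ) A =
      ∑ i, ∑ j, A i j • Matrix.toEuclideanCLM (𝕜 := ℝ) (Matrix.single i j (1 : ℝ)) := by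
    intro A
    conv_lhs => rw [Matrix.matrix_eq_sum_single A]
    simp only [map_sum, ← map_smul, Matrix.smul_single, smul_eq_mul, mul_one]
  refine ⟨∑ i, ∑ j, (fderiv ℝ (fun x => S.M x i j) q).smulRight
    (Matrix.toEuclideanCLM (𝕜 := ℝ) (Matrix.single i j (1 : ℝ))), ?_, fun qd => ?_⟩
  · simp_rw [hsum (S.M _)]
    refine HasStrictFDerivAt.fun_sum fun i _ => HasStrictFDerivAt.fun_sum fun j _ => ?_
    have hij : HasStrictFDerivAt (fun x => S.M x i j) (fderiv ℝ (fun x => S.M x i j) q) q :=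
      (hS.contDiff i j).contDiffAt.hasStrictFDerivAt one_ne_zero
    exact hij.smul_const (Matrix.toEuclideanCLM (𝕜 := ℝ) (Matrix.single i j (1 : ℝ)))
  · rw [hsum (S.Mdot q qd)]
    simp [Mdot]

/-- The energy `(q, e) ↦ ½ eᵀ M(q) e`. -/
noncomputable def energy (S : ELSystem n)
    (z : EuclideanSpace ℝ (Fin n) × EuclideanSpace ℝ (Fin n)) : ℝ :=
  1 / 2 * inner ℝ z.2 ((S.M z.1).toEuclideanLin z.2)

theorem Standing.exists_hasStrictFDerivAt_energy (hS : S.Standing μ₁ μ₂)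
    (q e : EuclideanSpace ℝ (Fin n)) :
    ∃ G' : EuclideanSpace ℝ (Fin n) × EuclideanSpace ℝ (Fin n) →L[ℝ] ℝ,
      HasStrictFDerivAt S.energy G' (q, e) ∧
      ∀ a b, G' (a, b) = 1 / 2 * inner ℝ e ((S.Mdot q a).toEuclideanLin e) +
        inner ℝ b ((S.M q).toEuclideanLin e) := by
  obtain ⟨M', hM', hM'eq⟩ := hS.exists_hasStrictFDerivAt q
  have hfst : HasStrictFDerivAt (fun z : EuclideanSpace ℝ (Fin n) × EuclideanSpace ℝ (Fin n) => z.1)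
      (ContinuousLinearMap.fst ℝ _ _) (q, e) := hasStrictFDerivAt_fst
  have hsnd : HasStrictFDerivAt (fun z : EuclideanSpace ℝ (Fin n) × EuclideanSpace ℝ (Fin n) => z.2)
      (ContinuousLinearMap.snd ℝ _ _) (q, e) := hasStrictFDerivAt_snd
  have hMz := HasStrictFDerivAt.comp (q, e)
    (f := fun z : EuclideanSpace ℝ (Fin n) × EuclideanSpace ℝ (Fin n) => z.1) hM' hfst
  have h := ((hsnd.inner ℝ (hMz.clm_apply hsnd))).const_mul (1 / 2)
  refine ⟨_, h, fun a b => ?_⟩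
  have hsym := hS.inner_comm q e b
  simp only [fderivInnerCLM_apply, smul_apply, ContinuousLinearMap.comp_apply,
    ContinuousLinearMap.prod_apply, add_apply, ContinuousLinearMap.flip_apply,
    ContinuousLinearMap.coe_fst', ContinuousLinearMap.coe_snd', hM'eq, inner_add_right,
    smul_eq_mul]
  change 1 / 2 * (inner ℝ e ((S.M q).toEuclideanLin b) + inner ℝ e
    ((S.Mdot q a).toEuclideanLin e) + inner ℝ b ((S.M q).toEuclideanLin e)) = _
  rw [hsym]
  ring

end ELSystem

/-! ### Local Lipschitz continuity of the barrier function -/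

section LocalLipschitz

variable {X : Type*} [NormedAddCommGroup X]

theorem exists_lipschitzOnWith_max {f g : X → ℝ} {x : X}
    (hf : ∃ K : ℝ≥0, ∃ U ∈ nhds x, LipschitzOnWith K f U)
    (hg : ∃ K : ℝ≥0, ∃ U ∈ nhds x, LipschitzOnWith K g U) :
    ∃ K : ℝ≥0, ∃ U ∈ nhds x, LipschitzOnWith K (fun y => max (f y) (g y)) U := by
  obtain ⟨K, U, hU, hf⟩ := hf
  obtain ⟨K', U', hU', hg⟩ := hg
  refine ⟨max K K', U ∩ U', Filter.inter_mem hU hU',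
    LipschitzOnWith.of_dist_le_mul fun y hy z hz => ?_⟩
  have h1 := hf.dist_le_mul y hy.1 z hz.1
  have h2 := hg.dist_le_mul y hy.2 z hz.2
  rw [Real.dist_eq] at h1 h2 ⊢
  refine (abs_max_sub_max_le_max _ _ _ _).trans (max_le (h1.trans ?_) (h2.trans ?_))
  · exact mul_le_mul_of_nonneg_right (NNReal.coe_le_coe.2 (le_max_left _ _)) dist_nonneg
  · exact mul_le_mul_of_nonneg_right (NNReal.coe_le_coe.2 (le_max_right _ _)) dist_nonneg

theorem abs_ciSup_sub_ciSup_le {ι : Type*} [Finite ι] [Nonempty ι] {f g : ι → ℝ} {C : ℝ}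
    (h : ∀ i, |f i - g i| ≤ C) : |(⨆ i, f i) - ⨆ i, g i| ≤ C := by
  obtain ⟨i, hi⟩ := exists_eq_ciSup_of_finite (f := f)
  obtain ⟨j, hj⟩ := exists_eq_ciSup_of_finite (f := g)
  have h1 : f j ≤ ⨆ i, f i := le_ciSup (Set.finite_range f).bddAbove j
  have h2 : g i ≤ ⨆ i, g i := le_ciSup (Set.finite_range g).bddAbove i
  have h3 := abs_le.1 (h i)
  have h4 := abs_le.1 (h j)
  rw [abs_le]
  constructor <;> linarith

/-- Local Lipschitz continuity of `z ↦ G (z₁, z₂ - ψ (z₁, z₃))`. -/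
theorem exists_lipschitzOnWith_error {E : Type*} [NormedAddCommGroup E]
    {ψ : E → E → E} {q qd vc : E} {L : ℝ} (hL : 0 ≤ L)
    (hψ : ∃ U ∈ nhds q, ∀ q₁ ∈ U, ∀ q₂ ∈ U, ∀ v₁ v₂, ‖ψ q₁ v₁ - ψ q₂ v₂‖ ≤
      L * (‖q₁ - q₂‖ + ‖v₁ - v₂‖))
    {G : E × E → ℝ} (hG : ∃ K : ℝ≥0, ∃ U ∈ nhds (q, qd - ψ q vc), LipschitzOnWith K G U) :
    ∃ K : ℝ≥0, ∃ U ∈ nhds (q, qd, vc),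
      LipschitzOnWith K (fun y : E × E × E => G (y.1, y.2.1 - ψ y.1 y.2.2)) U := by
  obtain ⟨U, hU, hLip⟩ := hψ
  obtain ⟨K, V, hV, hG⟩ := hG
  set z : E × E × E → E × E := fun y => (y.1, y.2.1 - ψ y.1 y.2.2)
  have hUn : Prod.fst ⁻¹' U ∈ nhds (q, qd, vc) := continuousAt_fst hU
  have hz : LipschitzOnWith (Real.toNNReal (1 + 2 * L)) z (Prod.fst ⁻¹' U) := by
    refine LipschitzOnWith.of_dist_le_mul fun y hy y' hy' => ?_
    rw [Real.coe_toNNReal _ (by positivity), dist_eq_norm, dist_eq_norm]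
    have n1 : ‖y.1 - y'.1‖ ≤ ‖y - y'‖ := norm_fst_le (y - y')
    have n2 : ‖y.2 - y'.2‖ ≤ ‖y - y'‖ := norm_snd_le (y - y')
    have n3 : ‖y.2.1 - y'.2.1‖ ≤ ‖y - y'‖ := (norm_fst_le (y.2 - y'.2)).trans n2
    have n4 : ‖y.2.2 - y'.2.2‖ ≤ ‖y - y'‖ := (norm_snd_le (y.2 - y'.2)).trans n2
    have n5 := hLip _ hy _ hy' y.2.2 y'.2.2
    rw [Prod.norm_def, max_le_iff]
    constructor
    · change ‖y.1 - y'.1‖ ≤ _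
      nlinarith [norm_nonneg (y - y')]
    · change ‖y.2.1 - ψ y.1 y.2.2 - (y'.2.1 - ψ y'.1 y'.2.2)‖ ≤ _
      rw [sub_sub_sub_comm]
      refine (norm_sub_le _ _).trans ?_
      nlinarith [norm_nonneg (y - y')]
  have hzc : ContinuousAt z (q, qd, vc) := hz.continuousOn.continuousAt hUn
  refine ⟨K * Real.toNNReal (1 + 2 * L), Prod.fst ⁻¹' U ∩ z ⁻¹' V,
    Filter.inter_mem hUn (hzc hV), ?_⟩
  exact hG.comp (hz.mono Set.inter_subset_left) fun y hy => hy.2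

end LocalLipschitz

/-! ### Estimates for the closed loop -/

section Estimates

variable {n N m : ℕ} {O : Obstacles n N} {D : Design} {da db dh vbar dr : ℝ}

/-- The sum of the coefficients is at least `1` by the triangle inequality for unit vectors, and at
most `1 / c₀` on pairing the combination with `lo`. -/
theorem IsPositiveBasis.exists_coeff {c₀ : ℝ} {l : Fin m → EuclideanSpace ℝ (Fin n)}
    (hl : IsPositiveBasis c₀ l) {lo : EuclideanSpace ℝ (Fin n)} (hlo : ‖lo‖ = 1) :
    ∃ ρ : Fin m → ℝ, (∀ p, 0 ≤ ρ p) ∧ (∀ p, ρ p ≠ 0 → c₀ ≤ inner ℝ (l p) lo) ∧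
      lo = ∑ p, ρ p • l p ∧ 1 ≤ ∑ p, ρ p ∧ (∑ p, ρ p) * c₀ ≤ 1 := by
  obtain ⟨-, ρ, h1, h2, h3⟩ := hl.2 lo hlo
  refine ⟨ρ, h1, h2, h3, ?_, ?_⟩
  · calc (1 : ℝ) = ‖∑ p, ρ p • l p‖ := by rw [← h3, hlo]
      _ ≤ ∑ p, ‖ρ p • l p‖ := norm_sum_le _ _
      _ = ∑ p, ρ p := Finset.sum_congr rfl fun p _ => by
        rw [norm_smul, hl.1 p, mul_one, Real.norm_of_nonneg (h1 p)]
  · calc (∑ p, ρ p) * c₀ = ∑ p, ρ p * c₀ := Finset.sum_mul _ _ _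
      _ ≤ ∑ p, ρ p * inner ℝ (l p) lo := Finset.sum_le_sum fun p _ => by
        by_cases hp : ρ p = 0
        · simp [hp]
        · exact mul_le_mul_of_nonneg_left (h2 p hp) (h1 p)
      _ = inner ℝ (∑ p, ρ p • l p) lo := by
        rw [sum_inner]
        exact Finset.sum_congr rfl fun p _ => (real_inner_smul_left _ _ _).symm
      _ = 1 := by rw [← h3, real_inner_self_eq_norm_sq, hlo, one_pow]

/-- A bound on the components along the basis vectors close to `lo` bounds the component
along `lo`. -/
theorem IsPositiveBasis.exists_inner_le {c₀ : ℝ} {l : Fin m → EuclideanSpace ℝ (Fin n)}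
    (hl : IsPositiveBasis c₀ l) {lo v : EuclideanSpace ℝ (Fin n)} (hlo : ‖lo‖ = 1) {β : ℝ}
    (hv : ∀ p, c₀ ≤ inner ℝ (l p) lo → inner ℝ (l p) v ≤ β) :
    ∃ σ : ℝ, 1 ≤ σ ∧ σ * c₀ ≤ 1 ∧ inner ℝ lo v ≤ σ * β := by
  obtain ⟨ρ, h1, h2, h3, h4, h5⟩ := hl.exists_coeff hlo
  refine ⟨_, h4, h5, ?_⟩
  calc inner ℝ lo v = ∑ p, ρ p * inner ℝ (l p) v := by
        conv_lhs => rw [h3]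
        rw [sum_inner]
        exact Finset.sum_congr rfl fun p _ => real_inner_smul_left _ _ _
    _ ≤ ∑ p, ρ p * β := Finset.sum_le_sum fun p _ => by
        by_cases hp : ρ p = 0
        · simp [hp]
        · exact mul_le_mul_of_nonneg_left (hv p (h2 p hp)) (h1 p)
    _ = _ := (Finset.sum_mul _ _ _).symm

/-- Apply the component bound along `v / ‖v‖`: the factor `c₀` in the cap compensates `σ ≤ 1 / c₀`.
-/
theorem norm_le_of_mem_qpFeasible (hv : 0 < vbar - dr)
    {l : Fin m → EuclideanSpace ℝ (Fin n)} (hl : IsPositiveBasis D.c₀ l)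
    {q v : EuclideanSpace ℝ (Fin n)} (h : v ∈ qpFeasible O D l vbar dr q) : ‖v‖ ≤ vbar - dr := by
  rcases (norm_nonneg v).eq_or_lt with h0 | h0
  · rw [← h0]
    exact hv.le
  obtain ⟨σ, -, h2, h3⟩ := hl.exists_inner_le (norm_inv_smul_self h0) (v := v)
    fun p _ => (h p).2
  rw [real_inner_smul_left, real_inner_self_eq_norm_sq] at h3
  have e : ‖v‖⁻¹ * ‖v‖ ^ 2 = ‖v‖ := by field_simp
  rw [e] at h3
  nlinarith

/-- The velocities admitted by the quadratic program do not point towards an obstacle. -/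
theorem exists_inner_dir_le (hO : O.DistanceCondition da db dh)
    (hD : D.Admissible O da db dh vbar dr)
    {l : Fin m → EuclideanSpace ℝ (Fin n)} (hl : IsPositiveBasis D.c₀ l)
    {q v : EuclideanSpace ℝ (Fin n)} (h : v ∈ qpFeasible O D l vbar dr q) {j : Fin N}
    (hq : -dh ≤ O.h j q) :
    ∃ σ : ℝ, 1 ≤ σ ∧ σ * D.c₀ ≤ 1 ∧
      inner ℝ (O.dir j q) v ≤ σ * (D.c₀ * D.α (O.h j q) - dr) := by
  have hnd := O.norm_dir hO.dh_lt hq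
  refine hl.exists_inner_le hnd fun p hp => (h p).1.trans ?_
  have hI := inner_mem_Icc_of_norm_eq_one hnd (hl.1 p)
  rw [real_inner_comm] at hp
  have h1 := regDist_le (O := O) (D := D) q (l p) j
  rw [hD.φ_zero _ ⟨hp, hI.2⟩, add_zero] at h1
  have h2 := mul_le_mul_of_nonneg_left (hD.α_classKe.2.1.monotone h1) hD.c₀_pos.le
  linarith

/-- The two bounds on `σ` act on different terms: `σ c₀ ≤ 1` on `α ≥ 0`, and `σ ≥ 1` on `-dr`. -/
theorem inner_dir_le_of_nonneg (hO : O.DistanceCondition da db dh) (hdr : 0 < dr)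
    (hD : D.Admissible O da db dh vbar dr)
    {l : Fin m → EuclideanSpace ℝ (Fin n)} (hl : IsPositiveBasis D.c₀ l)
    {q v : EuclideanSpace ℝ (Fin n)} (h : v ∈ qpFeasible O D l vbar dr q) {j : Fin N}
    (hq : 0 ≤ O.h j q) : inner ℝ (O.dir j q) v ≤ D.α (O.h j q) - dr := by
  obtain ⟨σ, h1, h2, h3⟩ := exists_inner_dir_le hO hD hl h (j := j) (by linarith [hO.dh_pos])
  have h4 : 0 ≤ D.α (O.h j q) := by
    have := hD.α_classKe.2.1.monotone hq
    rwa [hD.α_classKe.2.2] at this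
  nlinarith [mul_le_mul_of_nonneg_right h2 h4, mul_le_mul_of_nonneg_right h1 hdr.le]

theorem inner_dir_le_of_nonpos (hO : O.DistanceCondition da db dh) (hdr : 0 < dr)
    (hD : D.Admissible O da db dh vbar dr)
    {l : Fin m → EuclideanSpace ℝ (Fin n)} (hl : IsPositiveBasis D.c₀ l)
    {q v : EuclideanSpace ℝ (Fin n)} (h : v ∈ qpFeasible O D l vbar dr q) {j : Fin N}
    (hq : -dh ≤ O.h j q) (hq0 : O.h j q ≤ 0) : inner ℝ (O.dir j q) v ≤ -dr := by
  obtain ⟨σ, h1, -, h3⟩ := exists_inner_dir_le hO hD hl h hq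
  have h4 : D.α (O.h j q) ≤ 0 := by
    have := hD.α_classKe.2.1.monotone hq0
    rwa [hD.α_classKe.2.2] at this
  have h5 : D.c₀ * D.α (O.h j q) ≤ 0 := mul_nonpos_of_nonneg_of_nonpos hD.c₀_pos.le h4
  nlinarith

/-- Cauchy-Schwarz gives `‖a‖ - ‖a - t w‖ ≤ t ⟨a / ‖a‖, w⟩` at every nearby base point, and the
direction is continuous away from the obstacle centre. -/
theorem clarkeRateLE_neg_h {q : EuclideanSpace ℝ (Fin n)} {j : Fin N} (hq : 0 < ‖O.pos j - q‖)
    (qd vc : EuclideanSpace ℝ (Fin n))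
    (w : EuclideanSpace ℝ (Fin n) × EuclideanSpace ℝ (Fin n) × EuclideanSpace ℝ (Fin n)) :
    ClarkeRateLE (fun x : EuclideanSpace ℝ (Fin n) × EuclideanSpace ℝ (Fin n) ×
      EuclideanSpace ℝ (Fin n) => -O.h j x.1) (q, qd, vc) w (inner ℝ (O.dir j q) w.1) := by
  have hc : ContinuousAt (fun x : EuclideanSpace ℝ (Fin n) × EuclideanSpace ℝ (Fin n) ×
      EuclideanSpace ℝ (Fin n) => inner ℝ (O.dir j x.1) w.1) (q, qd, vc) := by
    have ha : ContinuousAt (fun x : EuclideanSpace ℝ (Fin n) × EuclideanSpace ℝ (Fin n) ×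
        EuclideanSpace ℝ (Fin n) => O.pos j - x.1) (q, qd, vc) := by fun_prop
    have hi : ContinuousAt (fun x : EuclideanSpace ℝ (Fin n) × EuclideanSpace ℝ (Fin n) ×
        EuclideanSpace ℝ (Fin n) => ‖O.pos j - x.1‖⁻¹) (q, qd, vc) :=
      ha.norm.inv₀ hq.ne'
    exact (hi.smul ha).inner continuousAt_const
  refine ClarkeRateLE.of_tendsto (hc.tendsto.comp (tendsto_fst_nhds _)) ?_
  filter_upwards [eventually_pos_prod (q, qd, vc)] with p hp
  simp only [Function.comp_apply, Obstacles.h, Obstacles.dir, Prod.fst_add, Prod.smul_fst]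
  set a := O.pos j - p.1.1 with ha
  have e : O.pos j - (p.1.1 + p.2 • w.1) = a - p.2 • w.1 := by
    rw [ha]
    abel
  rw [e, real_inner_smul_left]
  -- At the centre itself the direction is `0` by the convention `0⁻¹ = 0`, and the inequality is
  -- trivial.
  rcases (norm_nonneg a).eq_or_lt with h0 | h0
  · rw [← h0]
    simp
  · have h1 := real_inner_le_norm a (a - p.2 • w.1)
    rw [inner_sub_right, inner_smul_right, real_inner_self_eq_norm_sq] at h1
    have h2 : ‖a‖ - ‖a - p.2 • w.1‖ ≤ ‖a‖⁻¹ * (p.2 * inner ℝ a w.1) := by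
      rw [inv_mul_eq_div, le_div_iff₀ h0]
      linarith [sq ‖a‖]
    linarith

/-- The energy of the tracking error decays along the closed loop up to the drift of the
reference. -/
theorem clarkeRateLE_trackingW {S : ELSystem n} {μ₁ μ₂ : ℝ} (hS : S.Standing μ₁ μ₂)
    {ψ : EuclideanSpace ℝ (Fin n) → EuclideanSpace ℝ (Fin n) → EuclideanSpace ℝ (Fin n)}
    {q qd vc : EuclideanSpace ℝ (Fin n)} {L : ℝ} (hL : 0 ≤ L)
    (hψ : ∃ U ∈ nhds q, ∀ q₁ ∈ U, ∀ q₂ ∈ U, ∀ v₁ v₂, ‖ψ q₁ v₁ - ψ q₂ v₂‖ ≤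
      L * (‖q₁ - q₂‖ + ‖v₁ - v₂‖))
    {kD : ℝ} {qdd vcdot : EuclideanSpace ℝ (Fin n)}
    (hmotion : S.Motion q qd qdd (S.trackingInput kD q qd (ψ q vc))) (vcd vbar dr : ℝ) :
    ClarkeRateLE (trackingW S ψ μ₁ μ₂ vcd vbar dr kD L) (q, qd, vc) (qd, qdd, vcdot)
      (-kD * ‖qd - ψ q vc‖ ^ 2 + μ₂ * ‖qd - ψ q vc‖ * (L * (‖qd‖ + ‖vcdot‖))) := by
  set e := qd - ψ q vc with he
  obtain ⟨G', hG, hG'⟩ := hS.exists_hasStrictFDerivAt_energy q e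
  have hM : ∀ d, G' (0, d) ≤ (μ₂ * ‖e‖) * ‖d‖ := by
    intro d
    have h0 : (S.Mdot q 0) = 0 := by
      ext i j
      simp [ELSystem.Mdot]
    rw [hG', h0]
    simp only [map_zero, LinearMap.zero_apply, inner_zero_right, mul_zero, zero_add]
    refine (real_inner_le_norm _ _).trans ?_
    rw [mul_comm]
    exact mul_le_mul_of_nonneg_right (hS.norm_le q e) (norm_nonneg _)
  have hrate := (ClarkeRateLE.of_hasStrictFDerivAt_error hL hψ hG hM
    (mul_nonneg hS.upper_pos.le (norm_nonneg _)) qd qdd vcdot).const_add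
    (-(n * L * μ₁ * μ₂ ^ 2 * (vcd + vbar - dr) * dr / (μ₁ * kD - 2 * n * L * μ₂ ^ 2)))
  refine ClarkeRateLE.mono hrate (add_le_add_left (le_of_eq ?_) _)
  -- The closed loop reads `M q̈ = -C e - kD e`; paired with `e`, its `C` term cancels half the `Ṁ`
  -- form.
  have hMq : (S.M q).toEuclideanLin qdd = -(S.C q qd).toEuclideanLin e - kD • e := by
    have h1 := hmotion
    unfold ELSystem.Motion ELSystem.trackingInput at h1
    rw [he, map_sub]
    rw [← sub_eq_zero] at h1 ⊢
    rw [← h1]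
    abel
  rw [hG', hS.inner_Mdot, hS.inner_comm q qdd e, hMq, inner_sub_right, inner_neg_right,
    inner_smul_right, real_inner_self_eq_norm_sq]
  ring

end Estimates

/-! ### Choice of the decay rate -/

section Scalars

/-- The gain condition makes the tracking level small compared with the margin `dr` and large
compared with the drift of the reference. -/
theorem tracking_level_bounds {n : ℕ} (hn : 0 < n) {μ₁ μ₂ L kD vcd vbar dr : ℝ} (hμ₁ : 0 < μ₁)
    (hμ : μ₁ ≤ μ₂) (hL : 0 < L) (hvcd : 0 < vcd) (hdr : 0 < dr) (hv : 0 < vbar - dr)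
    (hkD : kD > 2 * n * L * (μ₂ ^ 3 * (vcd + vbar) / (μ₁ ^ 2 * dr))) {c : ℝ}
    (hc : c = n * L * μ₁ * μ₂ ^ 2 * (vcd + vbar - dr) * dr / (μ₁ * kD - 2 * n * L * μ₂ ^ 2)) :
    0 < c ∧ 2 * c < μ₁ * dr ^ 2 ∧ 0 < kD - μ₂ * L ∧
      4 * (μ₂ * L * (vcd + vbar - dr)) ^ 2 * μ₂ ≤ (kD - μ₂ * L) ^ 2 * (2 * c) := by
  have hμ₂ : 0 < μ₂ := hμ₁.trans_le hμ
  have hn1 : (1 : ℝ) ≤ n := by exact_mod_cast hn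
  set A := vcd + vbar - dr with hA
  have hA0 : 0 < A := by linarith
  have hV : vcd + vbar = A + dr := by linarith
  rw [hV] at hkD
  set P := 2 * n * L * μ₂ ^ 2 with hP
  have hP0 : 0 < P := by positivity
  have hP1 : 2 * L * μ₂ ^ 2 ≤ P := by
    rw [hP]
    nlinarith [mul_nonneg (sub_nonneg.2 hn1) (mul_nonneg hL.le (sq_nonneg μ₂))]
  have H1 : P * (A + dr) < dr * μ₁ * kD := by
    have e : 2 * n * L * (μ₂ ^ 3 * (A + dr) / (μ₁ ^ 2 * dr)) = P * μ₂ * (A + dr) / (μ₁ ^ 2 * dr) := by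
      rw [hP]
      ring
    rw [e, gt_iff_lt, div_lt_iff₀ (by positivity)] at hkD
    have h2 : P * μ₁ * (A + dr) ≤ P * μ₂ * (A + dr) := by gcongr
    have h3 : μ₁ * (P * (A + dr)) < μ₁ * (dr * μ₁ * kD) := by nlinarith
    exact lt_of_mul_lt_mul_left h3 hμ₁.le
  have hden : 0 < μ₁ * kD - P := by
    have h1 : dr * P < dr * (μ₁ * kD) := by nlinarith [mul_pos hP0 hA0]
    have := lt_of_mul_lt_mul_left h1 hdr.le
    linarith
  have hc2 : 2 * c * (μ₁ * kD - P) = P * μ₁ * A * dr := by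
    rw [hc, hP]
    rw [hP] at hden
    field_simp
  have hcpos : 0 < c := by
    have : 0 < 2 * c * (μ₁ * kD - P) := by
      rw [hc2]
      positivity
    have := pos_of_mul_pos_left this hden.le
    linarith
  have hk2 : 2 * L * μ₂ * (A + dr) < dr * kD := by
    have h1 : 2 * L * μ₂ * μ₁ * (A + dr) ≤ P * (A + dr) := by
      have : 2 * L * μ₂ * μ₁ ≤ P := by nlinarith [mul_pos hL hμ₂]
      exact mul_le_mul_of_nonneg_right this (by positivity)
    have h2 : μ₁ * (2 * L * μ₂ * (A + dr)) < μ₁ * (dr * kD) := by nlinarith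
    exact lt_of_mul_lt_mul_left h2 hμ₁.le
  have hk3 : 2 * μ₂ * L * A < (kD - μ₂ * L) * dr := by
    nlinarith [mul_pos (mul_pos hL hμ₂) hdr]
  have hk0 : 0 < kD - μ₂ * L := by
    have : 0 < (kD - μ₂ * L) * dr := lt_trans (by positivity) hk3
    exact pos_of_mul_pos_left this hdr.le
  refine ⟨hcpos, ?_, hk0, ?_⟩
  · have h1 : 2 * c * (μ₁ * kD - P) < μ₁ * dr ^ 2 * (μ₁ * kD - P) := by
      rw [hc2]
      nlinarith [mul_pos hμ₁ hdr]
    exact lt_of_mul_lt_mul_right h1 hden.le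
  · have h1 : μ₁ * kD - P ≤ μ₁ * (kD - μ₂ * L) := by nlinarith [mul_pos hL hμ₂]
    have h2 : P * A * dr ≤ 2 * c * (kD - μ₂ * L) := by
      have h3 := mul_le_mul_of_nonneg_left h1 hcpos.le
      have h4 : μ₁ * (P * A * dr) ≤ μ₁ * (2 * c * (kD - μ₂ * L)) := by nlinarith
      exact le_of_mul_le_mul_left h4 hμ₁
    have h5 : 2 * L * μ₂ ^ 2 * A * dr ≤ 2 * c * (kD - μ₂ * L) :=
      (mul_le_mul_of_nonneg_right (mul_le_mul_of_nonneg_right hP1 hA0.le) hdr.le).trans h2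
    have h6 := mul_le_mul_of_nonneg_left h5 hk0.le
    have h7 := mul_le_mul_of_nonneg_left hk3.le
      (by positivity : (0 : ℝ) ≤ 2 * L * μ₂ ^ 2 * A)
    nlinarith

/-- Decay of the tracking energy, in terms of the size `s` of the tracking error. -/
theorem tracking_decay {μ c k b ε B s w : ℝ} (hμ : 0 < μ) (hc : 0 < c) (hk : 0 < k) (hb : 0 ≤ b)
    (hkb : 4 * b ^ 2 * μ ≤ k ^ 2 * (2 * c)) (hs : 0 ≤ s) (hw : w + c ≤ 1 / 2 * (μ * s ^ 2))
    (hε : ε * μ ≤ k) (hB : b ^ 2 ≤ B * (3 * k * c)) (hB0 : 0 ≤ B) :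
    -k * s ^ 2 + b * s ≤ -piecewiseLinear B ε w := by
  rcases le_total 0 w with h0 | h0
  -- For `w ≥ 0` the energy is at least `c`, so `k s ≥ 2b` and half of the damping survives.
  · rw [piecewiseLinear_of_nonneg _ _ h0]
    have h1 : (2 * b) ^ 2 ≤ (k * s) ^ 2 := by
      have h2 : μ * (2 * b) ^ 2 ≤ μ * (k * s) ^ 2 := by
        have := mul_le_mul_of_nonneg_left (show 2 * c ≤ μ * s ^ 2 by linarith) (sq_nonneg k)
        nlinarith
      exact le_of_mul_le_mul_left h2 hμ
    have h3 : 2 * b ≤ k * s := (sq_le_sq₀ (by positivity) (by positivity)).1 h1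
    have h4 := mul_le_mul_of_nonneg_right h3 hs
    have h5 : μ * (ε * w) ≤ μ * (1 / 2 * (k * s ^ 2)) := by
      have := mul_le_mul_of_nonneg_right hε h0
      have := mul_le_mul_of_nonneg_left (show w ≤ 1 / 2 * (μ * s ^ 2) by linarith) hk.le
      nlinarith
    have h6 := le_of_mul_le_mul_left h5 hμ
    nlinarith
  · rw [piecewiseLinear_of_nonpos _ _ h0]
    -- Above `-3c/4` the energy is at least `c/4`, so `k s ≥ b` and the rate is nonpositive. Below,
    -- the maximum `b² / (4k)` of the quadratic in `s` is at most `B (3c/4)`.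
    rcases le_total (-(3 / 4 * c)) w with h1 | h1
    · have h2 : b ^ 2 ≤ (k * s) ^ 2 := by
        have h3 : μ * b ^ 2 ≤ μ * (k * s) ^ 2 := by
          have := mul_le_mul_of_nonneg_left (show 1 / 4 * (2 * c) ≤ μ * s ^ 2 by linarith)
            (sq_nonneg k)
          nlinarith
        exact le_of_mul_le_mul_left h3 hμ
      have h4 : b ≤ k * s := (sq_le_sq₀ hb (by positivity)).1 h2
      have h5 := mul_le_mul_of_nonneg_right h4 hs
      have h6 := mul_nonpos_of_nonneg_of_nonpos hB0 h0
      nlinarith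
    · have h2 : 4 * k * (-k * s ^ 2 + b * s) ≤ 4 * k * (B * (3 / 4 * c)) := by
        nlinarith [sq_nonneg (2 * k * s - b)]
      have h3 := le_of_mul_le_mul_left h2 (by positivity)
      nlinarith

/-- At `d = 0` the inequalities are strict, so they persist for small `d`. The result keeps a
tracking error at most `dr - ε d` where `W ≤ d`, reserving `ε d` of the margin for decay. -/
theorem exists_margin {c μ dr ε Δ : ℝ} (hdr : 0 < dr) (hΔ : 0 < Δ)
    (hc : 2 * c < μ * dr ^ 2) :
    ∃ d > 0, d < Δ ∧ 0 ≤ dr - ε * d ∧ 2 * (c + d) ≤ μ * (dr - ε * d) ^ 2 := by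
  have hf : Continuous fun d : ℝ => μ * (dr - ε * d) ^ 2 - 2 * (c + d) := by fun_prop
  have hg : Continuous fun d : ℝ => dr - ε * d := by fun_prop
  have h1 := ((hf.tendsto 0).eventually_const_lt (u := 0) (by simp; linarith)).filter_mono
    (nhdsWithin_le_nhds (s := Set.Ioi 0))
  have h2 := ((hg.tendsto 0).eventually_const_lt (u := 0) (by simpa using hdr)).filter_mono
    (nhdsWithin_le_nhds (s := Set.Ioi 0))
  have h3 : ∀ᶠ d in nhdsWithin (0 : ℝ) (Set.Ioi 0), d ∈ Set.Ioo 0 Δ := Ioo_mem_nhdsGT hΔ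
  obtain ⟨d, ⟨h1, h2⟩, h3⟩ := ((h1.and h2).and h3).exists
  exact ⟨d, h3.1, h3.2, h2.le, by linarith⟩

end Scalars

/-! ### Local regularity of `W` on the sublevel set. -/

section ClosedLoop

variable {n N m : ℕ}

theorem ELSystem.Standing.lower_le_upper {S : ELSystem n} {μ₁ μ₂ : ℝ} (hS : S.Standing μ₁ μ₂)
    (hn : 0 < n) : μ₁ ≤ μ₂ := by
  have h1 := hS.le_inner 0 (EuclideanSpace.single ⟨0, hn⟩ (1 : ℝ))
  have h2 := hS.inner_le 0 (EuclideanSpace.single ⟨0, hn⟩ (1 : ℝ))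
  have h3 : ‖EuclideanSpace.single (⟨0, hn⟩ : Fin n) (1 : ℝ)‖ = 1 := by simp
  rw [h3] at h1 h2
  linarith

theorem OuterLipschitz.locally {O : Obstacles n N}
    {ψ : EuclideanSpace ℝ (Fin n) → EuclideanSpace ℝ (Fin n) → EuclideanSpace ℝ (Fin n)}
    {Δ L : ℝ} (h : OuterLipschitz O ψ Δ L) {q : EuclideanSpace ℝ (Fin n)}
    (hq : ∀ i, -Δ < O.h i q) :
    ∃ U ∈ nhds q, ∀ q₁ ∈ U, ∀ q₂ ∈ U, ∀ v₁ v₂,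
      ‖ψ q₁ v₁ - ψ q₂ v₂‖ ≤ L * (‖q₁ - q₂‖ + ‖v₁ - v₂‖) := by
  refine ⟨{q | ∀ i, -Δ < O.h i q}, ?_, fun q₁ h₁ q₂ h₂ v₁ v₂ =>
    h q₁ q₂ v₁ v₂ fun i => le_min (h₁ i).le (h₂ i).le⟩
  refine Filter.eventually_all.2 fun i => ?_
  have hc : Continuous (O.h i) := by
    unfold Obstacles.h
    fun_prop
  exact (hc.tendsto q).eventually_const_lt (hq i)

theorem exists_lipschitzOnWith_trackingW {S : ELSystem n} {μ₁ μ₂ : ℝ} (hS : S.Standing μ₁ μ₂)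
    {ψ : EuclideanSpace ℝ (Fin n) → EuclideanSpace ℝ (Fin n) → EuclideanSpace ℝ (Fin n)}
    {q : EuclideanSpace ℝ (Fin n)} {L : ℝ} (hL : 0 ≤ L)
    (hψ : ∃ U ∈ nhds q, ∀ q₁ ∈ U, ∀ q₂ ∈ U, ∀ v₁ v₂, ‖ψ q₁ v₁ - ψ q₂ v₂‖ ≤
      L * (‖q₁ - q₂‖ + ‖v₁ - v₂‖))
    (qd vc : EuclideanSpace ℝ (Fin n)) (vcd vbar dr kD : ℝ) :
    ∃ K : ℝ≥0, ∃ U ∈ nhds (q, qd, vc),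
      LipschitzOnWith K (trackingW S ψ μ₁ μ₂ vcd vbar dr kD L) U := by
  obtain ⟨G', hG, -⟩ := hS.exists_hasStrictFDerivAt_energy q (qd - ψ q vc)
  obtain ⟨K, U, hU, h⟩ := exists_lipschitzOnWith_error hL hψ hG.exists_lipschitzOnWith
  refine ⟨K, U, hU, LipschitzOnWith.of_dist_le_mul fun y hy z hz => ?_⟩
  have := h.dist_le_mul y hy z hz
  rwa [← dist_add_left (-(n * L * μ₁ * μ₂ ^ 2 * (vcd + vbar - dr) * dr /
    (μ₁ * kD - 2 * n * L * μ₂ ^ 2)))] at this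

theorem exists_lipschitzOnWith_iSup_neg_h (hN : 0 < N) (O : Obstacles n N)
    (x : EuclideanSpace ℝ (Fin n) × EuclideanSpace ℝ (Fin n) × EuclideanSpace ℝ (Fin n)) :
    ∃ K : ℝ≥0, ∃ U ∈ nhds x, LipschitzOnWith K (fun x : EuclideanSpace ℝ (Fin n) ×
      EuclideanSpace ℝ (Fin n) × EuclideanSpace ℝ (Fin n) => ⨆ i, -O.h i x.1) U := by
  have : Nonempty (Fin N) := ⟨⟨0, hN⟩⟩
  refine ⟨1, Set.univ, Filter.univ_mem, LipschitzOnWith.of_dist_le_mul fun y _ z _ => ?_⟩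
  rw [Real.dist_eq, NNReal.coe_one, one_mul, dist_eq_norm]
  refine abs_ciSup_sub_ciSup_le fun i => ?_
  have h1 := abs_norm_sub_norm_le (O.pos i - z.1) (O.pos i - y.1)
  rw [sub_sub_sub_cancel_left] at h1
  have e : -O.h i y.1 - -O.h i z.1 = ‖O.pos i - z.1‖ - ‖O.pos i - y.1‖ := by
    unfold Obstacles.h
    ring
  rw [e]
  exact h1.trans (norm_fst_le (y - z))

end ClosedLoop

/-! ### The assembled theorem. -/

theorem theorem1 {n N : ℕ} (hn : 0 < n) (hN : 0 < N)
    (S : ELSystem n) (μ₁ μ₂ : ℝ) (hS : S.Standing μ₁ μ₂)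
    (vcd : ℝ) (hvcd : 0 < vcd)
    (O : Obstacles n N) (hds : ∀ i, 0 < O.ds i)
    (da db dh : ℝ) (hO : O.DistanceCondition da db dh)
    (vbar dr : ℝ) (hvbar : 0 < vbar) (hdr : 0 < dr)
    (ha1 : √2 * O.dsMin > da)
    (ha2 : vbar > 2 * dr)
    (ha3 : (2 * O.dsMin ^ 2 - da ^ 2) / (2 * (O.dsMax + db / 2) ^ 2) >
      1 - (vbar - 2 * dr) ^ 2 / (2 * (vbar - dr) ^ 2)) :
    (∃ D : Design, D.Admissible O da db dh vbar dr) ∧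
    ∀ D : Design, D.Admissible O da db dh vbar dr →
    ∀ (m : ℕ) (l : Fin m → EuclideanSpace ℝ (Fin n)), IsPositiveBasis D.c₀ l →
    ∃ Δh > 0,
      (∀ q vc, (∀ i, -Δh ≤ O.h i q) → ∃! v, IsQPSolution O D l vbar dr q vc v) ∧
      (∃ L > 0, OuterLipschitz O (qpMap O D l vbar dr) Δh L) ∧
      ∀ L > 0, OuterLipschitz O (qpMap O D l vbar dr) Δh L →
      ∀ kD > 2 * n * L * (μ₂ ^ 3 * (vcd + vbar) / (μ₁ ^ 2 * dr)),
      ∃ αw : ℝ → ℝ, IsClassKe αw ∧ (∃ K : ℝ≥0, LipschitzWith K αw) ∧ ∃ dw > 0,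
        ∀ q qd vc : EuclideanSpace ℝ (Fin n),
          maxW S O (qpMap O D l vbar dr) μ₁ μ₂ vcd vbar dr kD L (q, qd, vc) ≤ dw →
          (∃ K : ℝ≥0, ∃ U ∈ nhds (q, qd, vc), LipschitzOnWith K
            (maxW S O (qpMap O D l vbar dr) μ₁ μ₂ vcd vbar dr kD L) U) ∧
          ∀ qdd vcdot : EuclideanSpace ℝ (Fin n), ‖vcdot‖ ≤ vcd →
          S.Motion q qd qdd (S.trackingInput kD q qd (qpMap O D l vbar dr q vc)) →
          ∀ δ ∈ clarkeGradient
            (maxW S O (qpMap O D l vbar dr) μ₁ μ₂ vcd vbar dr kD L) (q, qd, vc),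
            δ (qd, qdd, vcdot) ≤
              -αw (maxW S O (qpMap O D l vbar dr) μ₁ μ₂ vcd vbar dr kD L (q, qd, vc)) := by
  have hv : 0 < vbar - dr := by linarith
  refine ⟨exists_admissible hN O hO hdr ha2 ha3, fun D hD m l hl => ?_⟩
  obtain ⟨Δ, hΔ0, hΔ, hda⟩ := hO.exists_tolerance hN ha1
  have hne : ∀ q, (∀ i, -Δ ≤ O.h i q) → (qpFeasible O D l vbar dr q).Nonempty := fun q hq =>
    qpFeasible_nonempty hN hO hdr hv hD hl.1 hΔ hda hq
  refine ⟨Δ, hΔ0, fun q vc hq => existsUnique_isQPSolution (hne q hq) vc,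
    exists_outerLipschitz hN hO hD hl.1 hΔ hne, fun L hL hLip kD hkD => ?_⟩
  have : Nonempty (Fin N) := ⟨⟨0, hN⟩⟩
  have hμ₁ := hS.lower_pos
  have hμ₂ := hS.upper_pos
  obtain ⟨c, hc⟩ : ∃ c, c = n * L * μ₁ * μ₂ ^ 2 * (vcd + vbar - dr) * dr /
    (μ₁ * kD - 2 * n * L * μ₂ ^ 2) := ⟨_, rfl⟩
  obtain ⟨hc0, hcdr, hk, hkb⟩ := tracking_level_bounds hn hμ₁ (hS.lower_le_upper hn) hL hvcd hdr
    hv hkD hc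
  obtain ⟨Kα, hKα⟩ := hD.α_lipschitz
  set b := μ₂ * L * (vcd + vbar - dr) with hb
  have hb0 : 0 ≤ b := mul_nonneg (by positivity) (by linarith)
  set k := kD - μ₂ * L with hkdef
  -- `ε` is the decay slope allowed by the damping; `B` must dominate both the Lipschitz constant of
  -- `α` and the worst growth of the tracking energy below zero, with `1` added for positivity.
  obtain ⟨ε, hε⟩ : ∃ ε, ε = k / μ₂ := ⟨_, rfl⟩
  obtain ⟨B, hB⟩ : ∃ B : ℝ, B = Kα + b ^ 2 / (3 * k * c) + 1 := ⟨_, rfl⟩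
  have hε0 : 0 < ε := by
    rw [hε]
    positivity
  have hKα0 : (0 : ℝ) ≤ Kα := Kα.2
  have hq0 : 0 ≤ b ^ 2 / (3 * k * c) := by positivity
  have hB0 : 0 < B := by linarith
  have hBb : b ^ 2 ≤ B * (3 * k * c) := by
    rw [← div_le_iff₀ (by positivity)]
    linarith
  obtain ⟨dw, hdw0, hdwΔ, hdw1, hdw2⟩ := exists_margin (ε := ε) hdr hΔ0 hcdr
  refine ⟨piecewiseLinear B ε, isClassKe_piecewiseLinear hB0 hε0,
    ⟨_, lipschitzWith_piecewiseLinear hB0.le hε0.le⟩, dw, hdw0, fun q qd vc hW => ?_⟩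
  set ψ := qpMap O D l vbar dr with hψ
  set W := maxW S O ψ μ₁ μ₂ vcd vbar dr kD L with hWdef
  set e := qd - ψ q vc with he
  have hWle : ∀ i y, -O.h i y.1 ≤ W y := fun i y =>
    (le_ciSup (f := fun i => -O.h i y.1) (Set.finite_range _).bddAbove i).trans (le_max_left _ _)
  have hTle : ∀ y, trackingW S ψ μ₁ μ₂ vcd vbar dr kD L y ≤ W y := fun y => le_max_right _ _
  have hh : ∀ i, -dw ≤ O.h i q := fun i => by
    have := (hWle i (q, qd, vc)).trans hW
    change -O.h i q ≤ dw at this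
    linarith
  have hloc := hLip.locally (q := q) fun i => by linarith [hh i]
  have hTlip := exists_lipschitzOnWith_trackingW hS hL.le hloc qd vc vcd vbar dr kD
  have hT : trackingW S ψ μ₁ μ₂ vcd vbar dr kD L (q, qd, vc) =
      -c + 1 / 2 * inner ℝ e ((S.M q).toEuclideanLin e) := by
    rw [hc]
    rfl
  refine ⟨exists_lipschitzOnWith_max (exists_lipschitzOnWith_iSup_neg_h hN O _) hTlip,
    fun qdd vcdot hvcdot hmotion δ hδ => ?_⟩
  have hfeas : ψ q vc ∈ qpFeasible O D l vbar dr q :=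
    (isQPSolution_qpMap (hne q fun i => by linarith [hh i]) vc).1
  refine ClarkeRateLE.apply_le ?_ hδ
  refine ClarkeRateLE.of_max
    (F := fun (i : Option (Fin N)) y => i.elim (trackingW S ψ μ₁ μ₂ vcd vbar dr kD L y)
      fun j => -O.h j y.1) ?_ ?_ ?_ ?_
  · rintro (_ | i) y
    · exact hTle y
    · exact hWle i y
  · intro y
    rcases max_choice (⨆ i, -O.h i y.1) (trackingW S ψ μ₁ μ₂ vcd vbar dr kD L y) with h | h
    · obtain ⟨i, hi⟩ := exists_eq_ciSup_of_finite (f := fun i => -O.h i y.1)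
      exact ⟨some i, h.trans hi.symm⟩
    · exact ⟨none, h⟩
  · rintro (_ | i)
    · obtain ⟨K, U, hU, h⟩ := hTlip
      exact h.continuousOn.continuousAt hU
    · simp only [Option.elim_some, Obstacles.h]
      fun_prop
  · rintro (_ | j) hact
    -- Tracking term active: bounding `‖qd‖` by `‖e‖ + vbar - dr` reduces the rate to `-k‖e‖² +
    -- b‖e‖`.
    · simp only [Option.elim_none] at hact ⊢
      refine (clarkeRateLE_trackingW hS hL.le hloc hmotion vcd vbar dr).mono ?_
      rw [hT] at hact
      have h1 := hS.inner_le q e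
      refine le_trans ?_ (tracking_decay hμ₂ hc0 hk hb0 hkb (norm_nonneg e)
        (w := W (q, qd, vc)) (by linarith) (ε := ε) (B := B) ?_ hBb hB0.le)
      · have h2 := norm_le_of_mem_qpFeasible hv hl hfeas
        have h3 : ‖qd‖ ≤ ‖e‖ + (vbar - dr) := by
          have : qd = e + ψ q vc := by
            rw [he]
            abel
          rw [this]
          exact (norm_add_le _ _).trans (by linarith)
        have h4 : μ₂ * ‖e‖ * (L * (‖qd‖ + ‖vcdot‖)) ≤
            μ₂ * ‖e‖ * (L * (‖e‖ + (vbar - dr) + vcd)) := by gcongr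
        have h5 : -kD * ‖e‖ ^ 2 + μ₂ * ‖e‖ * (L * (‖e‖ + (vbar - dr) + vcd)) =
            -k * ‖e‖ ^ 2 + b * ‖e‖ := by
          rw [hkdef, hb]
          ring
        linarith
      · rw [hε]
        field_simp
        exact le_rfl
    · simp only [Option.elim_some] at hact ⊢
      have hhj := hh j
      have hpos : 0 < ‖O.pos j - q‖ :=
        (sub_pos.2 (by linarith [hO.dh_lt] : dw < O.dsMin)).trans_le (O.le_norm_of_le_h hhj)
      refine (clarkeRateLE_neg_h hpos qd vc (qd, qdd, vcdot)).mono ?_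
      have hnd := O.norm_dir (by linarith [hO.dh_lt] : dw < O.dsMin) hhj
      have h1 : inner ℝ (O.dir j q) qd ≤ inner ℝ (O.dir j q) (ψ q vc) + ‖e‖ := by
        have h2 := real_inner_le_norm (O.dir j q) e
        rw [hnd, one_mul, he, inner_sub_right] at h2
        linarith
      have hTe := hTle (q, qd, vc)
      rw [hT] at hTe
      have h2 : μ₁ * ‖e‖ ^ 2 ≤ 2 * (c + W (q, qd, vc)) := by linarith [hS.le_inner q e]
      rw [← hact] at h2 hW ⊢
      -- Obstacle `j` active, so `W = -h_j`. Outside it, `W ≤ 0` gives `‖e‖ ≤ dr` and the approach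
      -- speed is at most `α(h_j)`; inside it, `‖e‖ ≤ dr - ε dw` leaves a retreat speed of at least
      -- `ε dw ≥ ε W`.
      rcases le_total 0 (O.h j q) with h0 | h0
      · have h3 := inner_dir_le_of_nonneg hO hdr hD hl hfeas h0
        have h4 : ‖e‖ ≤ dr := by
          refine (sq_le_sq₀ (norm_nonneg _) hdr.le).1 (le_of_mul_le_mul_left ?_ hμ₁)
          linarith
        have h5 : D.α (O.h j q) ≤ Kα * O.h j q := by
          have := hKα.dist_le_mul (O.h j q) 0
          rw [hD.α_classKe.2.2, Real.dist_eq, Real.dist_eq, sub_zero, sub_zero,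
            abs_of_nonneg h0] at this
          exact (le_abs_self _).trans this
        have h6 : Kα * O.h j q ≤ B * O.h j q := mul_le_mul_of_nonneg_right (by linarith) h0
        rw [piecewiseLinear_of_nonpos _ _ (by linarith : -O.h j q ≤ 0)]
        change inner ℝ (O.dir j q) qd ≤ _
        linarith
      · have h3 := inner_dir_le_of_nonpos hO hdr hD hl hfeas (by linarith) h0
        have h4 : ‖e‖ ≤ dr - ε * dw := by
          refine (sq_le_sq₀ (norm_nonneg _) hdw1).1 (le_of_mul_le_mul_left ?_ hμ₁)
          linarith
        rw [piecewiseLinear_of_nonneg _ _ (by linarith : 0 ≤ -O.h j q)]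
        have h5 := mul_le_mul_of_nonneg_left hW hε0.le
        change inner ℝ (O.dir j q) qd ≤ _
        linarith
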